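/- Let $\rho\in L^\infty(0,1)$ be real-valued with $\rho>0$ almost everywhere. Let $A=(-\Delta_D)^{-1}$ be the bounded operator on $L^2(0,1)$ for which $v=Af$ solves $-v''=f$ on $[0,1]$, $v(0)=v(1)=0$; let $M_\rho f=\rho f$ be the multiplication operator; let $\{\lambda_k\}_{k\ge1}$ be the generalized eigenvalues, listed with multiplicity, of $$-u''=\lambda\rho u\ \text{ on }[0,1],\qquad u(0)=u(1)=0;$$ let $g(x,y)=x(1-y)$ for $0\le x\le y\le1$ and $g(x,y)=y(1-x)$ for $0\le y\le x\le 1$; let $\phi_n(x)=\sqrt2\sin n\pi x$, and let $\mathbf M(\rho)$ be the infinite matrix $$\mathbf M_{ij}(\rho)=\frac1{\pi^2ij}\int_0^1\phi_i(x)\phi_j(x)\rho(x)\,dx\qquad(i,j\ge1).$$ (Differential equations are understood in the sense that $u$ is differentiable on $[0,1]$, $u'$ is absolutely continuous, and the equation holds almost everywhere.) Then the generalized eigenvalues are positive and form an infinite sequence in which each has finite multiplicity; $g$ is the integral kernel of $A$, i.e. $(Af)(x)=\int_0^1g(x,y)f(y)\,dy$; and $$g(x,y)=\sum_{n=1}^\infty\frac1{n^2\pi^2}\phi_n(x)\phi_n(y)$$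 uniformly on $[0,1]^2$. For every integer $s\ge1$ the operator $(A\circ M_\rho)^s$ is of trace class, and its trace $\tau_s(\rho)=\mathrm{trace}((A\circ M_\rho)^s)$ (the same in every orthonormal basis) is real and satisfies $$\tau_s(\rho)=\sum_{k=1}^\infty\lambda_k^{-s}=\int_0^1\!\cdots\!\int_0^1\rho(x_1)g(x_1,x_2)\rho(x_2)g(x_2,x_3)\cdots\rho(x_s)g(x_s,x_1)\,dx_1\cdots dx_s=\mathrm{trace}(\mathbf M(\rho)^s),$$ where the integrand is integrable on $[0,1]^s$, the series defining the entries of the matrix powers $\mathbf M(\rho)^n$, $n\le s$, converge, and the trace of $\mathbf M(\rho)^s$ is the convergent sum of its diagonal entries. -/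

import Mathlib

open MeasureTheory Set Filter Topology
open scoped ENNReal InnerProductSpace

noncomputable section

namespace StringTrace

/-- Lebesgue measure on the interval `(0,1)`. -/
abbrev μ01 : Measure ℝ := volume.restrict (Ioo (0 : ℝ) 1)

/-- The complex Hilbert space `L²(0,1)`. -/
abbrev L2 : Type := Lp ℂ 2 μ01

/-- `u` solves `-u'' = f` on `[0,1]` with `u(0) = u(1) = 0`: the function `u` is differentiable on
`[0,1]` (one-sidedly at the end points), its derivative `v` is absolutely continuous on `[0,1]`,
and `v' = -f` almost everywhere. -/
def IsDirichletSolution (f u : ℝ → ℂ) : Prop :=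
  u 0 = 0 ∧ u 1 = 0 ∧
    ∃ v : ℝ → ℂ,
      (∀ x ∈ Icc (0 : ℝ) 1, HasDerivWithinAt u (v x) (Icc 0 1) x) ∧
      AbsolutelyContinuousOnInterval v 0 1 ∧
      ∀ᵐ x ∂μ01, HasDerivAt v (-f x) x

theorem IsDirichletSolution.congr {f g u : ℝ → ℂ} (h : IsDirichletSolution f u)
    (hfg : f =ᵐ[μ01] g) : IsDirichletSolution g u := by
  obtain ⟨h0, h1, v, hv, hac, hd⟩ := h
  refine ⟨h0, h1, v, hv, hac, ?_⟩
  filter_upwards [hd, hfg] with x hx hfx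
  rwa [← hfx]

theorem IsDirichletSolution.zero : IsDirichletSolution (fun _ => 0) (fun _ => 0) := by
  refine ⟨rfl, rfl, fun _ => 0, fun x _ => hasDerivWithinAt_const _ _ _, ?_, ?_⟩
  · exact (contDiff_const (n := 1)).contDiffOn.absolutelyContinuousOnInterval
  · exact Eventually.of_forall fun x => by simpa using hasDerivAt_const x (0 : ℂ)

theorem IsDirichletSolution.add {f g u w : ℝ → ℂ} (hu : IsDirichletSolution f u)
    (hw : IsDirichletSolution g w) :
    IsDirichletSolution (fun x => f x + g x) (fun x => u x + w x) := by
  obtain ⟨h0, h1, v, hv, hac, hd⟩ := hu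
  obtain ⟨k0, k1, z, hz, kac, kd⟩ := hw
  refine ⟨by simp [h0, k0], by simp [h1, k1], fun x => v x + z x,
    fun x hx => (hv x hx).fun_add (hz x hx), hac.fun_add kac, ?_⟩
  filter_upwards [hd, kd] with x hx kx
  simpa [add_comm] using hx.fun_add kx

theorem IsDirichletSolution.const_mul {f u : ℝ → ℂ} (c : ℂ) (hu : IsDirichletSolution f u) :
    IsDirichletSolution (fun x => c * f x) (fun x => c * u x) := by
  obtain ⟨h0, h1, v, hv, hac, hd⟩ := hu
  refine ⟨by simp [h0], by simp [h1], fun x => c * v x,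
    fun x hx => (hv x hx).const_mul c, hac.const_smul c, ?_⟩
  filter_upwards [hd] with x hx
  simpa using hx.const_mul c

/-- First antiderivative of `f` restricted to `(0,1)`. -/
def prim (f : ℝ → ℂ) (x : ℝ) : ℂ := ∫ t in (0 : ℝ)..x, (Ioo (0 : ℝ) 1).indicator f t

/-- Explicit solution of `-u'' = f`, `u(0) = u(1) = 0` by two integrations. -/
def dirichletSol (f : ℝ → ℂ) (x : ℝ) : ℂ :=
  x * (∫ t in (0 : ℝ)..1, prim f t) - ∫ t in (0 : ℝ)..x, prim f t

theorem integrable_ind {f : ℝ → ℂ} (hf : Integrable f μ01) :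
    Integrable ((Ioo (0 : ℝ) 1).indicator f) :=
  (integrable_indicator_iff measurableSet_Ioo).2 hf

theorem continuous_prim {f : ℝ → ℂ} (hf : Integrable f μ01) : Continuous (prim f) :=
  intervalIntegral.continuous_primitive (fun _ _ => (integrable_ind hf).intervalIntegrable) 0

theorem hasDerivAt_dirichletSol {f : ℝ → ℂ} (hf : Integrable f μ01) (x : ℝ) :
    HasDerivAt (dirichletSol f) ((∫ t in (0 : ℝ)..1, prim f t) - prim f x) x := by
  have hc := continuous_prim hf
  have h2 : HasDerivAt (fun x => ∫ t in (0 : ℝ)..x, prim f t) (prim f x) x :=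
    intervalIntegral.integral_hasDerivAt_right (hc.intervalIntegrable _ _)
      (hc.stronglyMeasurableAtFilter _ _) hc.continuousAt
  have h1 : HasDerivAt (fun x : ℝ => (x : ℂ) * (∫ t in (0 : ℝ)..1, prim f t))
      (1 * (∫ t in (0 : ℝ)..1, prim f t)) x :=
    (Complex.ofRealCLM.hasDerivAt (x := x)).mul_const _
  rw [one_mul] at h1
  exact h1.fun_sub h2

theorem absolutelyContinuous_primitive {f : ℝ → ℂ} (hf : Integrable f) :
    AbsolutelyContinuousOnInterval (fun x => ∫ t in (0 : ℝ)..x, f t) 0 1 := by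
  have h1 : AbsolutelyContinuousOnInterval (fun x => ∫ t in (0 : ℝ)..x, (f t).re) 0 1 :=
    hf.re.intervalIntegrable.absolutelyContinuousOnInterval_intervalIntegral (by simp)
  have h2 : AbsolutelyContinuousOnInterval (fun x => ∫ t in (0 : ℝ)..x, (f t).im) 0 1 :=
    hf.im.intervalIntegrable.absolutelyContinuousOnInterval_intervalIntegral (by simp)
  have hre : ∀ x, (∫ t in (0 : ℝ)..x, f t).re = ∫ t in (0 : ℝ)..x, (f t).re := fun x =>
    (Complex.reCLM.intervalIntegral_comp_comm hf.intervalIntegrable).symm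
  have him : ∀ x, (∫ t in (0 : ℝ)..x, f t).im = ∫ t in (0 : ℝ)..x, (f t).im := fun x =>
    (Complex.imCLM.intervalIntegral_comp_comm hf.intervalIntegrable).symm
  refine squeeze_zero (fun E => Finset.sum_nonneg fun i _ => dist_nonneg) (fun E => ?_)
    (by simpa using Tendsto.add h1 h2)
  rw [← Finset.sum_add_distrib]
  refine Finset.sum_le_sum fun i _ => ?_
  rw [Complex.dist_eq, Real.dist_eq, Real.dist_eq, ← hre, ← hre, ← him, ← him, ← Complex.sub_re,
    ← Complex.sub_im]
  exact Complex.norm_le_abs_re_add_abs_im _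

theorem isDirichletSolution_dirichletSol {f : ℝ → ℂ} (hf : Integrable f μ01) :
    IsDirichletSolution f (dirichletSol f) := by
  have hi := integrable_ind hf
  refine ⟨by simp [dirichletSol], by simp [dirichletSol],
    fun x => (∫ t in (0 : ℝ)..1, prim f t) - prim f x,
    fun x _ => (hasDerivAt_dirichletSol hf x).hasDerivWithinAt, ?_, ?_⟩
  · have h1 : AbsolutelyContinuousOnInterval (prim f) 0 1 :=
      absolutelyContinuous_primitive hi
    generalize (∫ t in (0 : ℝ)..1, prim f t) = c
    have h2 : AbsolutelyContinuousOnInterval (fun _ : ℝ => c) 0 1 :=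
      (contDiff_const (n := 1)).contDiffOn.absolutelyContinuousOnInterval
    exact h2.fun_sub h1
  · have h := LocallyIntegrable.ae_hasDerivAt_integral hi.locallyIntegrable
    filter_upwards [ae_restrict_of_ae h, ae_restrict_mem measurableSet_Ioo] with x hx hxm
    have h0 : HasDerivAt (prim f) (f x) x := by
      have := hx 0
      rwa [indicator_of_mem hxm] at this
    exact h0.const_sub _

theorem norm_prim_le {f : ℝ → ℂ} (hf : Integrable f μ01) (x : ℝ) :
    ‖prim f x‖ ≤ ∫ t, ‖f t‖ ∂μ01 := by
  have hi := (integrable_ind hf).norm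
  refine intervalIntegral.norm_integral_le_integral_norm_uIoc.trans ?_
  refine (setIntegral_le_integral hi (Eventually.of_forall fun _ => norm_nonneg _)).trans ?_
  rw [← integral_indicator measurableSet_Ioo]
  simp [norm_indicator_eq_indicator_norm]

theorem norm_dirichletSol_le {f : ℝ → ℂ} (hf : Integrable f μ01) {x : ℝ} (hx : x ∈ Icc (0 : ℝ) 1) :
    ‖dirichletSol f x‖ ≤ 2 * ∫ t, ‖f t‖ ∂μ01 := by
  set C := ∫ t, ‖f t‖ ∂μ01 with hC
  have hC0 : 0 ≤ C := integral_nonneg fun _ => norm_nonneg _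
  have hb : ∀ y ∈ Icc (0 : ℝ) 1, ‖∫ t in (0 : ℝ)..y, prim f t‖ ≤ C := fun y hy => by
    refine (intervalIntegral.norm_integral_le_of_norm_le_const
      (fun t _ => norm_prim_le hf t)).trans ?_
    rw [sub_zero, abs_of_nonneg hy.1]
    exact mul_le_of_le_one_right hC0 hy.2
  have h1 : ‖(x : ℂ) * (∫ t in (0 : ℝ)..1, prim f t)‖ ≤ C := by
    rw [norm_mul, Complex.norm_real, Real.norm_of_nonneg hx.1]
    exact (mul_le_of_le_one_left (norm_nonneg _) hx.2).trans (hb 1 (by simp))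
  calc ‖dirichletSol f x‖ ≤ C + C := (norm_sub_le _ _).trans (add_le_add h1 (hb x hx))
    _ = 2 * C := by ring

theorem integrable_L2 (f : L2) : Integrable f μ01 := (Lp.memLp f).integrable (by norm_num)

theorem ae_norm_dirichletSol_le {f : ℝ → ℂ} (hf : Integrable f μ01) :
    ∀ᵐ x ∂μ01, ‖dirichletSol f x‖ ≤ 2 * ∫ t, ‖f t‖ ∂μ01 := by
  filter_upwards [ae_restrict_mem measurableSet_Ioo] with x hx
  exact norm_dirichletSol_le hf (Ioo_subset_Icc_self hx)

theorem memLp_dirichletSol {f : ℝ → ℂ} (hf : Integrable f μ01) :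
    MemLp (dirichletSol f) 2 μ01 :=
  MemLp.of_bound
    (continuous_iff_continuousAt.2 fun x =>
      (hasDerivAt_dirichletSol hf x).continuousAt).aestronglyMeasurable
    _ (ae_norm_dirichletSol_le hf)

theorem prim_congr {f g : ℝ → ℂ} (h : f =ᵐ[μ01] g) : prim f = prim g := by
  funext x
  have : (Ioo (0 : ℝ) 1).indicator f =ᵐ[volume] (Ioo (0 : ℝ) 1).indicator g :=
    by
    filter_upwards [(ae_restrict_iff' measurableSet_Ioo).1 h] with t ht
    by_cases hm : t ∈ Ioo (0 : ℝ) 1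
    · simp [hm, ht hm]
    · simp [hm]
  exact intervalIntegral.integral_congr_ae (this.mono fun t ht _ => ht)

theorem dirichletSol_congr {f g : ℝ → ℂ} (h : f =ᵐ[μ01] g) : dirichletSol f = dirichletSol g := by
  funext x
  simp only [dirichletSol, prim_congr h]

theorem prim_add {f g : ℝ → ℂ} (hf : Integrable f μ01) (hg : Integrable g μ01) :
    prim (f + g) = prim f + prim g := by
  funext x
  simp only [prim, Pi.add_apply, indicator_add']
  exact intervalIntegral.integral_add (integrable_ind hf).intervalIntegrable
    (integrable_ind hg).intervalIntegrable

theorem dirichletSol_add {f g : ℝ → ℂ} (hf : Integrable f μ01) (hg : Integrable g μ01) :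
    dirichletSol (f + g) = dirichletSol f + dirichletSol g := by
  funext x
  have h := fun a b : ℝ => intervalIntegral.integral_add
    ((continuous_prim hf).intervalIntegrable (μ := volume) a b)
    ((continuous_prim hg).intervalIntegrable (μ := volume) a b)
  simp only [dirichletSol, prim_add hf hg, Pi.add_apply, h]
  ring

theorem dirichletSol_smul (c : ℂ) (f : ℝ → ℂ) : dirichletSol (c • f) = c • dirichletSol f := by
  have hp : prim (c • f) = c • prim f := by
    funext x
    have : (Ioo (0 : ℝ) 1).indicator (c • f) = fun t => c • (Ioo (0 : ℝ) 1).indicator f t :=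
      indicator_const_smul _ c f
    simp only [prim, this, Pi.smul_apply]
    exact intervalIntegral.integral_smul _ _
  funext x
  have hi : ∀ a b : ℝ, ∫ t in a..b, c * prim f t = c * ∫ t in a..b, prim f t :=
    fun _ _ => intervalIntegral.integral_const_mul _ _
  simp only [dirichletSol, hp, Pi.smul_apply, smul_eq_mul, hi]
  ring

theorem integral_norm_le_norm (f : L2) : ∫ t, ‖f t‖ ∂μ01 ≤ ‖f‖ := by
  have : IsProbabilityMeasure μ01 := ⟨by simp⟩
  have h1 : ∫ t, ‖f t‖ ∂μ01 = (eLpNorm f 1 μ01).toReal := by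
    rw [eLpNorm_one_eq_lintegral_enorm, integral_norm_eq_lintegral_enorm
      (Lp.aestronglyMeasurable f)]
  rw [h1, Lp.norm_def]
  exact ENNReal.toReal_mono (Lp.memLp f).eLpNorm_ne_top
    (eLpNorm_le_eLpNorm_of_exponent_le (by norm_num) (Lp.aestronglyMeasurable f))

/-- The Dirichlet problem `-v'' = f`, `v(0) = v(1) = 0` is solved by a bounded linear operator
on `L²(0,1)`. -/
theorem exists_dirichletInverse :
    ∃ A : L2 →L[ℂ] L2, ∀ f : L2, ∃ u : ℝ → ℂ, IsDirichletSolution f u ∧ A f =ᵐ[μ01] u := by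
  have : IsProbabilityMeasure μ01 := ⟨by simp⟩
  let L : L2 →ₗ[ℂ] L2 :=
    { toFun := fun f => (memLp_dirichletSol (integrable_L2 f)).toLp _
      map_add' := fun f g => by
        rw [← MemLp.toLp_add]
        refine MemLp.toLp_congr _ _ (Eventually.of_forall fun x => ?_)
        rw [dirichletSol_congr (Lp.coeFn_add f g),
          dirichletSol_add (integrable_L2 f) (integrable_L2 g)]
      map_smul' := fun c f => by
        rw [RingHom.id_apply, ← MemLp.toLp_const_smul]
        refine MemLp.toLp_congr _ _ (Eventually.of_forall fun x => ?_)
        rw [dirichletSol_congr (Lp.coeFn_smul c f), dirichletSol_smul] }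
  refine ⟨L.mkContinuous 2 fun f => ?_, fun f => ⟨dirichletSol f,
    isDirichletSolution_dirichletSol (integrable_L2 f),
    MemLp.coeFn_toLp (memLp_dirichletSol (integrable_L2 f))⟩⟩
  have hb : ∀ᵐ x ∂μ01, ‖L f x‖ ≤ 2 * ‖f‖ := by
    filter_upwards [MemLp.coeFn_toLp (memLp_dirichletSol (integrable_L2 f)),
      ae_norm_dirichletSol_le (integrable_L2 f)] with x hx hx2
    have : L f x = dirichletSol f x := hx
    rw [this]
    exact hx2.trans (by gcongr; exact integral_norm_le_norm f)
  have h := Lp.norm_le_of_ae_bound (by positivity) hb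
  have hm : measureUnivNNReal μ01 = 1 := by simp [measureUnivNNReal]
  simpa [hm] using h

/-- `A = (-Δ_D)⁻¹` on `L²(0,1)`: the bounded operator such that `v = A f` solves
`-v'' = f` on `[0,1]`, `v(0) = v(1) = 0`. -/
def dirichletInverse : L2 →L[ℂ] L2 := exists_dirichletInverse.choose

theorem dirichletInverse_spec (f : L2) :
    ∃ u : ℝ → ℂ, IsDirichletSolution f u ∧ dirichletInverse f =ᵐ[μ01] u :=
  exists_dirichletInverse.choose_spec f

/-- The operator `M_ρ f = ρ f` on `L²(0,1)` of multiplication by `ρ ∈ L^∞(0,1)`. -/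
def mulOperator (ρ : ℝ → ℝ) (hρ : MemLp ρ ∞ μ01) : L2 →L[ℂ] L2 :=
  (ContinuousLinearMap.mul ℂ ℂ).holderL μ01 ∞ 2 2 (hρ.ofReal (K := ℂ)).toLp

theorem mulOperator_apply (ρ : ℝ → ℝ) (hρ : MemLp ρ ∞ μ01) (f : L2) :
    mulOperator ρ hρ f =ᵐ[μ01] fun x => (ρ x : ℂ) * f x := by
  filter_upwards [ContinuousLinearMap.coeFn_holder (ContinuousLinearMap.mul ℂ ℂ)
    (r := 2) (hρ.ofReal (K := ℂ)).toLp f, (hρ.ofReal (K := ℂ)).coeFn_toLp] with x h1 h2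
  rw [mulOperator, ContinuousLinearMap.holderL_apply_apply, h1, h2]
  rfl

/-- The solutions in `L²(0,1)` of `-u'' = z ρ u`, `u(0) = u(1) = 0`. -/
def eigenspace (ρ : ℝ → ℝ) (z : ℂ) : Submodule ℂ L2 where
  carrier := {w | ∃ u : ℝ → ℂ,
    IsDirichletSolution (fun x => z * ρ x * u x) u ∧ w =ᵐ[μ01] u}
  zero_mem' := ⟨fun _ => 0, by simpa using IsDirichletSolution.zero, Lp.coeFn_zero _ _ _⟩
  add_mem' := by
    rintro a b ⟨u, hu, hau⟩ ⟨w, hw, hbw⟩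
    refine ⟨fun x => u x + w x, ?_, ?_⟩
    · simpa only [mul_add] using hu.add hw
    · exact (Lp.coeFn_add a b).trans (hau.add hbw)
  smul_mem' := by
    rintro c a ⟨u, hu, hau⟩
    refine ⟨fun x => c * u x, ?_, ?_⟩
    · exact (hu.const_mul c).congr (Eventually.of_forall fun x => by ring)
    · exact (Lp.coeFn_smul c a).trans (hau.const_smul c)

/-- `lam` lists the generalized eigenvalues of `-u'' = λ ρ u`, `u(0) = u(1) = 0`, each one as often
as its multiplicity, and lists nothing else. -/
def IsEigenvalueSequence (ρ : ℝ → ℝ) (lam : ℕ → ℂ) : Prop :=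
  ∀ z : ℂ, {k | lam k = z}.encard = Cardinal.toENat (Module.rank ℂ (eigenspace ρ z))

/-- `B` is of trace class: `∑ ⟨|B| e_k, e_k⟩ < ∞` for some orthonormal basis, `|B| = (B* B)^{1/2}`. -/
def IsTraceClass {H : Type} [NormedAddCommGroup H] [InnerProductSpace ℂ H] [CompleteSpace H]
    (B : H →L[ℂ] H) : Prop :=
  ∃ (ι : Type) (e : HilbertBasis ι ℂ H), Summable fun k => ⟪e k, CFC.abs B (e k)⟫_ℂ

/-- `B` is of trace class and its trace, computed in any orthonormal basis, is `t`. -/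
def HasTrace {H : Type} [NormedAddCommGroup H] [InnerProductSpace ℂ H] [CompleteSpace H]
    (B : H →L[ℂ] H) (t : ℂ) : Prop :=
  IsTraceClass B ∧
    ∀ (ι : Type) (e : HilbertBasis ι ℂ H), HasSum (fun k => ⟪e k, B (e k)⟫_ℂ) t

/-- The Green's function of the Dirichlet Laplacian on `[0,1]`. -/
def green (x y : ℝ) : ℝ := if x ≤ y then x * (1 - y) else y * (1 - x)

/-- `ρ(x₁) g(x₁,x₂) ρ(x₂) g(x₂,x₃) ⋯ ρ(x_s) g(x_s,x₁)`. -/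
def cyclicIntegrand (ρ : ℝ → ℝ) (s : ℕ) (x : Fin s → ℝ) : ℝ :=
  ∏ i : Fin s, ρ (x i) * green (x i) (x (finRotate s i))

/-- The normalized Dirichlet eigenfunctions `φ_n(x) = √2 sin(n π x)`. -/
def phi (n : ℕ+) (x : ℝ) : ℝ := √2 * Real.sin ((n : ℝ) * Real.pi * x)

/-- The infinite matrix `M_{ij}(ρ) = (π² i j)⁻¹ ∫₀¹ φ_i φ_j ρ`. -/
def momentMatrix (ρ : ℝ → ℝ) (i j : ℕ+) : ℝ :=
  1 / (Real.pi ^ 2 * i * j) * ∫ x, phi i x * phi j x * ρ x ∂μ01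

/-- Powers of an infinite matrix. -/
def matrixPow (M : ℕ+ → ℕ+ → ℝ) : ℕ → ℕ+ → ℕ+ → ℝ
  | 0 => fun i j => if i = j then 1 else 0
  | n + 1 => fun i j => ∑' k, M i k * matrixPow M n k j

/-- The powers of `M` up to the `s`-th one are given by convergent series, and the sum of the
diagonal entries of `M ^ s` converges to `t`. -/
def HasMatrixPowTrace (M : ℕ+ → ℕ+ → ℝ) (s : ℕ) (t : ℝ) : Prop :=
  (∀ n < s, ∀ i j, Summable fun k => M i k * matrixPow M n k j) ∧
    HasSum (fun i => matrixPow M s i i) t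

end StringTrace

end

/-! Write `A` for `dirichletInverse`, `M` for `mulOperator ρ hρ` and `S` for the positive square
root of `A`. The operator `A * M = S * (S * M)` need not be self-adjoint, but exchanging the two
factors gives `T = S * M * S`, which is nonnegative and self-adjoint. On the sine functions `S` acts
by `1 / (n π)`, so `S` is Hilbert-Schmidt because `∑ 1 / n²` converges.

For `s ≥ 1` one has `(A * M) ^ s = S * Z` and `T ^ s = Z * S` with `Z` also Hilbert-Schmidt. A
product of two Hilbert-Schmidt operators is of trace class (`IsHilbertSchmidt.isTraceClass_mul`),
and its trace is independent of the basis and unchanged when the factors are exchanged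
(`IsHilbertSchmidt.exists_hasSum_inner_mul`). Hence `(A * M) ^ s` and `T ^ s` have the same trace.
In an eigenbasis of `T` this trace is the sum of `λ_k ^ (-s)`, because `X * Y` and `Y * X` have
isomorphic eigenspaces away from zero (`rank_eigenspace_eq`). In the sine basis the matrix of `T` is
the moment matrix (`inner_symmOperator`), so the trace is that of its `s`-th power.

The cyclic integral is reached through the sine series of the Green's function, which comes from the
Fourier series of the second Bernoulli polynomial (`hasSum_green`). Integrating term by term turns
the integral into an absolutely convergent sum over closed index paths
(`hasSum_cyclic_momentMatrix`), and grouping by the starting index gives the trace of the matrix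
power. The same series, with the injectivity of `A`, proves that the sines are complete
(`orthogonal_span_phiL2`). -/

noncomputable section

namespace StringTrace

/-! ### Hilbert-Schmidt operators, traces and eigenbases. -/

section HilbertSchmidt

variable {H : Type} [NormedAddCommGroup H] [InnerProductSpace ℂ H] {ι κ : Type}

/-- `B` is a Hilbert-Schmidt operator: `∑ ‖B e_k‖² < ∞` for every orthonormal basis. -/
def IsHilbertSchmidt (B : H →L[ℂ] H) : Prop :=
  ∀ (ι : Type) (e : HilbertBasis ι ℂ H), Summable fun k => ‖B (e k)‖ ^ 2

theorem hasSum_norm_inner_sq (e : HilbertBasis ι ℂ H) (x : H) :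
    HasSum (fun k => ‖⟪e k, x⟫_ℂ‖ ^ 2) (‖x‖ ^ 2) := by
  have h := (e.hasSum_inner_mul_inner x x).mapL Complex.reCLM
  have h1 : Complex.reCLM ⟪x, x⟫_ℂ = ‖x‖ ^ 2 := inner_self_eq_norm_sq (𝕜 := ℂ) x
  rw [h1] at h
  refine h.congr_fun fun k => ?_
  rw [← inner_conj_symm x (e k), mul_comm, Complex.mul_conj,
    Complex.normSq_eq_norm_sq]
  exact (Complex.ofReal_re _).symm

theorem summable_norm_inner_sq_prod (e : HilbertBasis ι ℂ H) {v : κ → H} (hv : Orthonormal ℂ v)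
    {B : H →L[ℂ] H} (h : Summable fun k => ‖B (e k)‖ ^ 2) :
    Summable fun p : ι × κ => ‖⟪v p.2, B (e p.1)⟫_ℂ‖ ^ 2 := by
  have h0 : 0 ≤ fun p : ι × κ => ‖⟪v p.2, B (e p.1)⟫_ℂ‖ ^ 2 := fun p => sq_nonneg _
  refine (summable_prod_of_nonneg h0).2 ⟨fun k => hv.inner_products_summable (B (e k)), ?_⟩
  exact Summable.of_nonneg_of_le (fun k => tsum_nonneg fun n => sq_nonneg _)
    (fun k => hv.tsum_inner_products_le (B (e k))) h

theorem IsHilbertSchmidt.comp_left {B : H →L[ℂ] H} (h : IsHilbertSchmidt B) (C : H →L[ℂ] H) :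
    IsHilbertSchmidt (C * B) := fun ι e => by
  refine Summable.of_nonneg_of_le (fun k => by positivity) (fun k => ?_)
    ((h ι e).mul_left (‖C‖ ^ 2))
  rw [← mul_pow]
  gcongr
  exact C.le_opNorm _

variable [CompleteSpace H]

/-- Sum `|⟪v n, B (e k)⟫|²` over `k` first instead of `n`; Parseval in `e` then produces the
adjoint. -/
theorem summable_norm_adjoint_sq (e : HilbertBasis ι ℂ H) {v : κ → H} (hv : Orthonormal ℂ v)
    {B : H →L[ℂ] H} (h : Summable fun k => ‖B (e k)‖ ^ 2) :
    Summable fun n => ‖B.adjoint (v n)‖ ^ 2 := by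
  have h1 := (summable_norm_inner_sq_prod e hv h).prod_symm.prod
  refine h1.congr fun n => ?_
  rw [← (hasSum_norm_inner_sq e (B.adjoint (v n))).tsum_eq]
  refine tsum_congr fun k => ?_
  rw [ContinuousLinearMap.adjoint_inner_right, ← inner_conj_symm, RCLike.norm_conj]
  rfl

/-- Passing to the adjoint twice moves summability from `e` to an arbitrary basis. -/
theorem isHilbertSchmidt_of_summable (e : HilbertBasis ι ℂ H) {B : H →L[ℂ] H}
    (h : Summable fun k => ‖B (e k)‖ ^ 2) : IsHilbertSchmidt B := fun κ f => by
  simpa using summable_norm_adjoint_sq e f.orthonormal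
    (summable_norm_adjoint_sq e e.orthonormal h)

theorem IsHilbertSchmidt.adjoint {B : H →L[ℂ] H} (h : IsHilbertSchmidt B) :
    IsHilbertSchmidt B.adjoint := fun ι e =>
  summable_norm_adjoint_sq e e.orthonormal (h ι e)

theorem IsHilbertSchmidt.comp_right {B : H →L[ℂ] H} (h : IsHilbertSchmidt B) (C : H →L[ℂ] H) :
    IsHilbertSchmidt (B * C) := by
  have h1 := (h.adjoint.comp_left C.adjoint).adjoint
  have h2 : ContinuousLinearMap.adjoint (C.adjoint * B.adjoint) = B * C := by
    change star (star C * star B) = B * C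
    simp
  rwa [h2] at h1

/-- The trace of a product of two Hilbert-Schmidt operators exists, does not depend on the
orthonormal basis, and is invariant under exchanging the factors. -/
theorem IsHilbertSchmidt.exists_hasSum_inner_mul {Y Z : H →L[ℂ] H} (hY : IsHilbertSchmidt Y)
    (hZ : IsHilbertSchmidt Z) (e : HilbertBasis ι ℂ H) (f : HilbertBasis κ ℂ H) :
    ∃ t : ℂ, HasSum (fun k => ⟪e k, (Y * Z) (e k)⟫_ℂ) t ∧
      HasSum (fun n => ⟪f n, (Z * Y) (f n)⟫_ℂ) t := by
  -- The double series converges absolutely by `ab ≤ a² + b²`. Its two orders of summation give the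
  -- two traces.
  have hs : Summable fun p : ι × κ => ⟪e p.1, Y (f p.2)⟫_ℂ * ⟪f p.2, Z (e p.1)⟫_ℂ := by
    have h1 := (summable_norm_inner_sq_prod f e.orthonormal (hY κ f)).prod_symm
    have h2 := summable_norm_inner_sq_prod e f.orthonormal (hZ ι e)
    refine Summable.of_norm_bounded (h1.add h2) fun p => ?_
    rw [norm_mul]
    simp only [Prod.fst_swap, Prod.snd_swap]
    nlinarith [sq_nonneg (‖⟪e p.1, Y (f p.2)⟫_ℂ‖ - ‖⟪f p.2, Z (e p.1)⟫_ℂ‖),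
      sq_nonneg ‖⟪e p.1, Y (f p.2)⟫_ℂ‖, sq_nonneg ‖⟪f p.2, Z (e p.1)⟫_ℂ‖]
  have hs' := (Equiv.prodComm κ ι).hasSum_iff.2 hs.hasSum
  refine ⟨_, hs.hasSum.prod_fiberwise fun k => ?_, hs'.prod_fiberwise fun n => ?_⟩
  · have h := f.hasSum_inner_mul_inner (Y.adjoint (e k)) (Z (e k))
    simp only [ContinuousLinearMap.adjoint_inner_left] at h
    exact h
  · have h := e.hasSum_inner_mul_inner (Z.adjoint (f n)) (Y (f n))
    simp only [ContinuousLinearMap.adjoint_inner_left] at h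
    exact h.congr_fun fun k => mul_comm _ _

/-- Truncating the expansion of `x` gives finite-rank operators; by Cauchy-Schwarz the norm of the
error is at most the square root of the tail of `∑ ‖B (e k)‖²`. -/
theorem IsHilbertSchmidt.isCompactOperator {B : H →L[ℂ] H} (h : IsHilbertSchmidt B) :
    IsCompactOperator B := by
  obtain ⟨w, e, -⟩ := exists_hilbertBasis ℂ H
  have hs := h _ e
  let F : Finset w → H →L[ℂ] H := fun N => ∑ k ∈ N, (innerSL ℂ (e k)).smulRight (B (e k))
  have hF : ∀ N x, F N x = ∑ k ∈ N, ⟪e k, x⟫_ℂ • B (e k) := fun N x => by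
    simp [F]
  refine isCompactOperator_of_tendsto (l := atTop) (F := F) ?_ (Eventually.of_forall fun N => ?_)
  · have hsq : Tendsto (fun N : Finset w => √(∑' k : {k // k ∉ N}, ‖B (e k)‖ ^ 2)) atTop (𝓝 0) := by
      simpa using (tendsto_tsum_compl_atTop_zero fun k => ‖B (e k)‖ ^ 2).sqrt
    rw [tendsto_iff_norm_sub_tendsto_zero]
    refine squeeze_zero (fun _ => norm_nonneg _) (fun N => ?_) hsq
    refine ContinuousLinearMap.opNorm_le_bound _ (Real.sqrt_nonneg _) fun x => ?_
    have h1 : HasSum (fun k => ⟪e k, x⟫_ℂ • B (e k)) (B x) := by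
      have := (e.hasSum_repr x).mapL B
      simpa only [map_smul, e.repr_apply_apply] using this
    have h2 : HasSum (fun k : {k // k ∉ N} => ⟪e k, x⟫_ℂ • B (e k)) (B x - F N x) := by
      rw [hF]
      refine (Finset.hasSum_compl_iff (f := fun k => ⟪e k, x⟫_ℂ • B (e k)) N).2 ?_
      rwa [sub_add_cancel]
    have h3 : Summable fun k : {k // k ∉ N} => ‖B (e k)‖ ^ 2 := hs.subtype _
    have h4 : Summable fun k : {k // k ∉ N} => ‖⟪e k, x⟫_ℂ‖ ^ 2 :=
      (hasSum_norm_inner_sq e x).summable.subtype _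
    have h5 : ∑' k : {k // k ∉ N}, ‖⟪e k, x⟫_ℂ‖ ^ 2 ≤ ‖x‖ ^ 2 := by
      rw [← (hasSum_norm_inner_sq e x).tsum_eq]
      exact (hasSum_norm_inner_sq e x).summable.tsum_subtype_le _ _ fun k => by positivity
    rw [_root_.sub_apply, norm_sub_rev]
    refine le_of_tendsto h2.norm (Eventually.of_forall fun J => ?_)
    calc ‖∑ k ∈ J, ⟪e k, x⟫_ℂ • B (e k)‖ ≤ ∑ k ∈ J, ‖B (e k)‖ * ‖⟪e k, x⟫_ℂ‖ := by
          refine (norm_sum_le _ _).trans (Finset.sum_le_sum fun k _ => ?_)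
          rw [norm_smul, mul_comm]
      _ ≤ √(∑ k ∈ J, ‖B (e k)‖ ^ 2) * √(∑ k ∈ J, ‖⟪e k, x⟫_ℂ‖ ^ 2) :=
          Real.sum_mul_le_sqrt_mul_sqrt _ _ _
      _ ≤ √(∑' k : {k // k ∉ N}, ‖B (e k)‖ ^ 2) * ‖x‖ := by
          gcongr
          · exact h3.sum_le_tsum _ fun k _ => by positivity
          · exact Real.sqrt_le_iff.2 ⟨norm_nonneg _,
              (h4.sum_le_tsum _ fun k _ => by positivity).trans h5⟩
  · refine Submodule.sum_mem (compactOperator (RingHom.id ℂ) H H) fun k _ => ?_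
    change IsCompactOperator ((innerSL ℂ (e k)).smulRight (B (e k)))
    have h1 : IsCompactOperator (ContinuousLinearMap.toSpanSingleton ℂ (B (e k))) :=
      isCompactOperator_of_locallyCompactSpace_rng _
    exact h1.comp_clm (innerSL ℂ (e k))

/-- A self-adjoint Hilbert-Schmidt operator has an orthonormal basis of eigenvectors. -/
theorem IsHilbertSchmidt.exists_eigenbasis {T : H →L[ℂ] H} (h : IsHilbertSchmidt T)
    (hT : T.IsSymmetric) :
    ∃ (ι : Type) (e : HilbertBasis ι ℂ H) (m : ι → ℝ), ∀ k, T (e k) = (m k : ℂ) • e k := by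
  have hbot := ContinuousLinearMap.orthogonalComplement_iSup_eigenspaces_eq_bot
    h.isCompactOperator hT
  let V : ℂ → Submodule ℂ H := fun z => Module.End.eigenspace (T : Module.End ℂ H) z
  have hc : ∀ z, IsClosed (V z : Set H) := fun z => by
    have : (V z : Set H) = {x | T x = z • x} := by
      ext x
      exact Module.End.mem_eigenspace_iff
    rw [this]
    exact isClosed_eq T.continuous (continuous_const_smul z)
  have : ∀ z, CompleteSpace (V z) := fun z => (hc z).completeSpace_coe
  -- Bases of all the eigenspaces are glued together. Those of non-eigenvalues are trivial and
  -- contribute nothing.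
  choose w b hb using fun z => exists_hilbertBasis ℂ (V z)
  let v : (Σ z, w z) → H := fun p => (b p.1 p.2 : V p.1)
  have hV : OrthogonalFamily ℂ (fun z => V z) fun z => (V z).subtypeₗᵢ :=
    hT.orthogonalFamily_eigenspaces
  have hv : Orthonormal ℂ v := hV.orthonormal_sigma_orthonormal fun z => (b z).orthonormal
  have hsp : (Submodule.span ℂ (range v))ᗮ = ⊥ := by
    rw [eq_bot_iff, ← hbot]
    intro x hx
    rw [Submodule.mem_orthogonal] at hx ⊢
    refine fun y hy => Submodule.iSup_induction V (motive := fun y => ⟪y, x⟫_ℂ = 0) hy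
      (fun z y hy => ?_) (by simp) fun y z hy hz => by rw [inner_add_left, hy, hz, add_zero]
    have h1 := ((b z).hasSum_repr ⟨y, hy⟩).mapL (V z).subtypeL
    have h2 := h1.mapL (innerSL ℂ x)
    have h3 : ∀ i, innerSL ℂ x ((V z).subtypeL ((b z).repr ⟨y, hy⟩ i • b z i)) = 0 := fun i => by
      have := hx (v ⟨z, i⟩) (Submodule.subset_span ⟨_, rfl⟩)
      rw [← inner_conj_symm, starRingEnd_apply, star_eq_zero] at this
      simp only [map_smul, innerSL_apply_apply]
      exact (congrArg _ this).trans (smul_zero _)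
    simp only [h3] at h2
    have h4 := h2.unique hasSum_zero
    rw [← inner_conj_symm]
    exact (congrArg _ h4).trans (map_zero _)
  have hTv : ∀ p, T (v p) = p.1 • v p := fun p => Module.End.mem_eigenspace_iff.1 (b p.1 p.2).2
  refine ⟨_, HilbertBasis.mkOfOrthogonalEqBot hv hsp, fun p => p.1.re, fun p => ?_⟩
  rw [HilbertBasis.coe_mkOfOrthogonalEqBot, hTv]
  -- Symmetry makes the eigenvalue real, so taking its real part as `m` loses nothing.
  have h1 : ⟪T (v p), v p⟫_ℂ = ⟪v p, T (v p)⟫_ℂ := hT _ _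
  rw [hTv, inner_smul_left, inner_smul_right, inner_self_eq_norm_sq_to_K, hv.1 p] at h1
  rw [Complex.conj_eq_iff_re.1 (by simpa using h1)]

omit [CompleteSpace H] in
/-- Eigenvectors of the square of a nonnegative operator are eigenvectors of the operator. -/
theorem eigenvector_of_sq {Q : H →L[ℂ] H} (hQ : 0 ≤ Q) {c : ℝ} (hc : 0 ≤ c) {x : H}
    (hx : Q (Q x) = (c : ℂ) ^ 2 • x) : Q x = (c : ℂ) • x := by
  have hp := (ContinuousLinearMap.nonneg_iff_isPositive Q).1 hQ
  rcases hc.eq_or_lt with rfl | hc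
  · have h1 : ⟪Q x, Q x⟫_ℂ = ⟪x, Q (Q x)⟫_ℂ := hp.isSymmetric _ _
    rw [hx] at h1
    simpa using h1
  -- The defect `y` satisfies `Q y = -c y`, which for `Q ≥ 0` and `c > 0` is possible only if `y =
  -- 0`.
  · set y := Q x - (c : ℂ) • x with hy
    have h1 : Q y = -((c : ℂ) • y) := by
      rw [hy, map_sub, map_smul, hx, smul_sub, smul_smul, sq]
      abel
    have h2 : 0 ≤ RCLike.re ⟪y, Q y⟫_ℂ := hp.re_inner_nonneg_right y
    rw [h1, inner_neg_right, inner_smul_right, inner_self_eq_norm_sq_to_K] at h2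
    have h3 : c * ‖y‖ ^ 2 ≤ 0 := by
      have : ((c : ℂ) * ((‖y‖ : ℝ) : ℂ) ^ 2).re = c * ‖y‖ ^ 2 := by
        rw [← Complex.ofReal_pow, ← Complex.ofReal_mul, Complex.ofReal_re]
      simp only [map_neg, Left.nonneg_neg_iff] at h2
      exact this.symm.trans_le h2
    have h4 : ‖y‖ ^ 2 ≤ 0 := nonpos_of_mul_nonpos_right h3 hc
    have h5 : y = 0 := by simpa using le_antisymm h4 (sq_nonneg _)
    exact sub_eq_zero.1 h5

theorem exists_nonneg_mul_self_eq {Q : H →L[ℂ] H} (hQ : 0 ≤ Q) :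
    ∃ S : H →L[ℂ] H, 0 ≤ S ∧ S * S = Q :=
  ⟨CFC.sqrt Q, CFC.sqrt_nonneg Q, CFC.sqrt_mul_sqrt_self Q hQ⟩

/-- The product of two Hilbert-Schmidt operators is of trace class. -/
theorem IsHilbertSchmidt.isTraceClass_mul {Y Z : H →L[ℂ] H} (hY : IsHilbertSchmidt Y)
    (hZ : IsHilbertSchmidt Z) : IsTraceClass (Y * Z) := by
  set B := Y * Z with hB
  set P := CFC.abs B with hP
  have hpos := (ContinuousLinearMap.nonneg_iff_isPositive P).1 (CFC.abs_nonneg B)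
  -- Thus `|B|` inherits the Hilbert-Schmidt property from `B` and can be diagonalized.
  have hPP : ∀ x y, ⟪P x, P y⟫_ℂ = ⟪B x, B y⟫_ℂ := fun x y => by
    have h1 : P * P = B.adjoint * B := CFC.abs_mul_abs B
    have h2 : P (P y) = B.adjoint (B y) := DFunLike.congr_fun h1 y
    have h3 : ⟪P x, P y⟫_ℂ = ⟪x, P (P y)⟫_ℂ := hpos.isSymmetric _ _
    rw [h3, h2, ContinuousLinearMap.adjoint_inner_right]
  have hn : ∀ x, ‖P x‖ = ‖B x‖ := fun x => by
    rw [norm_eq_sqrt_re_inner (𝕜 := ℂ), hPP, ← norm_eq_sqrt_re_inner (𝕜 := ℂ)]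
  have hHS : IsHilbertSchmidt P := fun ι e => by
    simpa only [hn] using hZ.comp_left Y ι e
  obtain ⟨ι, e, m, he⟩ := hHS.exists_eigenbasis hpos.isSymmetric
  let J : Set ι := {k | B (e k) ≠ 0}
  -- In an eigenbasis of `|B|` the vectors `B (e k)` are orthogonal, so `f` plays the role of the
  -- partial isometry of the polar decomposition. Then `‖B (e k)‖ = ⟪Y* (f k), Z (e k)⟫` is
  -- dominated by two convergent sums of squares.
  let f : J → H := fun k => ((‖B (e k)‖ : ℂ)⁻¹) • B (e k)
  have hf : Orthonormal ℂ f := by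
    refine ⟨fun k => ?_, fun j k hjk => ?_⟩
    · have : ‖B (e k)‖ ≠ 0 := norm_ne_zero_iff.2 k.2
      simp [f, norm_smul, this]
    · have h1 : ⟪e j, e k⟫_ℂ = 0 := e.orthonormal.2 fun h => hjk (Subtype.ext h)
      have h2 : ⟪B (e j), B (e k)⟫_ℂ = 0 := by
        rw [← hPP, he, he, inner_smul_left, inner_smul_right, h1, mul_zero, mul_zero]
      simp only [f, inner_smul_left, inner_smul_right, h2, mul_zero]
  have hm : ∀ k, ‖⟪e k, P (e k)⟫_ℂ‖ = ‖B (e k)‖ := fun k => by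
    rw [← hn, he, inner_smul_right, inner_self_eq_norm_sq_to_K, e.orthonormal.1 k]
    simp [norm_smul, e.orthonormal.1 k]
  refine ⟨ι, e, ?_⟩
  refine (Subtype.val_injective (p := (· ∈ J))).summable_iff (fun k hk => ?_) |>.1 ?_
  · have : B (e k) = 0 := by
      by_contra h
      exact hk ⟨⟨k, h⟩, rfl⟩
    rw [← norm_eq_zero, hm, this, norm_zero]
  · obtain ⟨w, b, -⟩ := exists_hilbertBasis ℂ H
    refine Summable.of_norm_bounded ((summable_norm_adjoint_sq b hf (hY _ b)).add
      ((hZ ι e).subtype J)) fun k => ?_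
    have h0 : ‖B (e k)‖ ≠ 0 := norm_ne_zero_iff.2 k.2
    have h1 : ‖⟪f k, B (e k)⟫_ℂ‖ = ‖B (e k)‖ := by
      simp only [f, inner_smul_left, inner_self_eq_norm_sq_to_K, norm_mul]
      simp
      field_simp
    have h2 : ⟪f k, B (e k)⟫_ℂ = ⟪Y.adjoint (f k), Z (e k)⟫_ℂ := by
      rw [ContinuousLinearMap.adjoint_inner_left]
      rfl
    simp only [Function.comp_apply]
    rw [hm, ← h1, h2]
    refine (norm_inner_le_norm _ _).trans ?_
    nlinarith [sq_nonneg (‖Y.adjoint (f k)‖ - ‖Z (e k)‖), sq_nonneg ‖Y.adjoint (f k)‖,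
      sq_nonneg ‖Z (e k)‖]

omit [CompleteSpace H] in
/-- The multiplicity of an eigenvalue, read off from an eigenbasis. -/
theorem toENat_rank_eigenspace {T : H →L[ℂ] H} (hT : T.IsSymmetric) (e : HilbertBasis ι ℂ H)
    {m : ι → ℝ} (he : ∀ k, T (e k) = (m k : ℂ) • e k) {z : ℂ}
    (hz : {k | (m k : ℂ) = z}.Finite) :
    Cardinal.toENat (Module.rank ℂ (Module.End.eigenspace (T : Module.End ℂ H) z)) =
      {k | (m k : ℂ) = z}.encard := by
  set J : Set ι := {k | (m k : ℂ) = z} with hJ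
  let v : J → H := fun k => e k
  have hv : LinearIndependent ℂ v :=
    e.orthonormal.linearIndependent.comp _ Subtype.val_injective
  have hspan : Module.End.eigenspace (T : Module.End ℂ H) z = Submodule.span ℂ (range v) := by
    refine le_antisymm (fun x hx => ?_) (Submodule.span_le.2 ?_)
    · have hx' : T x = z • x := Module.End.mem_eigenspace_iff.1 hx
      -- Only finitely many coefficients survive, so `x` lies in the algebraic span, without
      -- closure.
      have h0 : ∀ k ∉ hz.toFinset, e.repr x k • e k = 0 := fun k hk => by
        have h1 : ⟪T (e k), x⟫_ℂ = ⟪e k, T x⟫_ℂ := hT _ _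
        rw [he, hx', inner_smul_left, inner_smul_right, Complex.conj_ofReal] at h1
        have h2 : (m k : ℂ) ≠ z := fun h => hk (hz.mem_toFinset.2 h)
        have h3 : ⟪e k, x⟫_ℂ = 0 := by
          by_contra h
          exact h2 (mul_right_cancel₀ h h1)
        rw [e.repr_apply_apply, h3, zero_smul]
      rw [(e.hasSum_repr x).unique (hasSum_sum_of_ne_finset_zero h0)]
      exact Submodule.sum_mem _ fun k hk => Submodule.smul_mem _ _
        (Submodule.subset_span ⟨⟨k, hz.mem_toFinset.1 hk⟩, rfl⟩)
    · rintro _ ⟨k, rfl⟩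
      refine Module.End.mem_eigenspace_iff.2 ?_
      have h := he k
      rw [show (m k : ℂ) = z from k.2] at h
      exact h
  rw [hspan, rank_span hv, Cardinal.mk_range_eq v hv.injective]
  rfl

/-- `XY` and `YX` have the same eigenspaces for nonzero eigenvalues. -/
def eigenspaceMulComm (X Y : Module.End ℂ H) {z : ℂ} (hz : z ≠ 0) :
    Module.End.eigenspace (X * Y) z ≃ₗ[ℂ] Module.End.eigenspace (Y * X) z where
  toFun w := ⟨Y w, Module.End.mem_eigenspace_iff.2 (by
    have h : X (Y w) = z • (w : H) := Module.End.mem_eigenspace_iff.1 w.2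
    rw [Module.End.mul_apply, h, map_smul])⟩
  map_add' a b := Subtype.ext (map_add Y _ _)
  map_smul' c a := Subtype.ext (map_smul Y _ _)
  invFun v := ⟨z⁻¹ • X v, Module.End.mem_eigenspace_iff.2 (by
    have h : Y (X v) = z • (v : H) := Module.End.mem_eigenspace_iff.1 v.2
    rw [map_smul, Module.End.mul_apply, h, map_smul, smul_comm])⟩
  left_inv w := Subtype.ext (by
    have h : X (Y w) = z • (w : H) := Module.End.mem_eigenspace_iff.1 w.2
    simp [h, hz])
  right_inv v := Subtype.ext (by
    have h : Y (X v) = z • (v : H) := Module.End.mem_eigenspace_iff.1 v.2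
    simp [h, hz])

end HilbertSchmidt

/-- Sequences taking each value equally often are permutations of each other. -/
theorem exists_perm_of_encard_eq {α : Type*} {a b : ℕ → α}
    (h : ∀ z, {k | a k = z}.encard = {k | b k = z}.encard) :
    ∃ σ : ℕ ≃ ℕ, ∀ k, b (σ k) = a k := by
  -- Fibres in `ℕ` are countable, and `Cardinal.toENat` is injective on cardinals up to `ℵ₀`.
  have h1 : ∀ z, Nonempty ({k // a k = z} ≃ {k // b k = z}) := fun z =>
    Cardinal.eq.1 (Cardinal.toENat_injOn Cardinal.mk_le_aleph0 Cardinal.mk_le_aleph0 (h z))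
  exact ⟨Equiv.ofFiberEquiv fun z => (h1 z).some, fun k => Equiv.ofFiberEquiv_map _ k⟩

instance isProbabilityMeasure_μ01 : IsProbabilityMeasure μ01 := ⟨by simp⟩

/-! ### Uniqueness for the Dirichlet problem and the Green's function. -/

section Dirichlet

theorem ae_of_ae_μ01 {p : ℝ → Prop} (h : ∀ᵐ x ∂μ01, p x) :
    ∀ᵐ x, x ∈ uIcc (0 : ℝ) 1 → p x := by
  have h1 := (ae_restrict_iff' measurableSet_Ioo).1 h
  have h2 : ∀ᵐ x : ℝ, x ∉ ({0, 1} : Set ℝ) :=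
    (Set.toFinite _).measure_zero volume |> measure_eq_zero_iff_ae_notMem.1
  filter_upwards [h1, h2] with x hx hx2 hx3
  rw [uIcc_of_le zero_le_one] at hx3
  simp only [mem_insert_iff, mem_singleton_iff, not_or] at hx2
  exact hx ⟨lt_of_le_of_ne hx3.1 (Ne.symm hx2.1), lt_of_le_of_ne hx3.2 hx2.2⟩

/-- Absolute continuity turns `v' = 0` almost everywhere into `v` constant; then `u` is affine and
vanishes at both ends. -/
theorem IsDirichletSolution.eq_zero {u : ℝ → ℂ} (h : IsDirichletSolution (fun _ => 0) u) :
    ∀ x ∈ Icc (0 : ℝ) 1, u x = 0 := by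
  obtain ⟨h0, h1, v, hv, hac, hd⟩ := h
  simp only [neg_zero] at hd
  obtain ⟨C, hC⟩ := hac.const_of_ae_hasDerivAt_zero (ae_of_ae_μ01 hd)
  rw [uIcc_of_le zero_le_one] at hC
  have hder : ∀ x ∈ Icc (0 : ℝ) 1, HasDerivWithinAt (fun x => u x - C * x) 0 (Icc 0 1) x := by
    intro x hx
    have h2 : HasDerivAt (fun x : ℝ => C * (x : ℂ)) (C * 1) x :=
      (Complex.ofRealCLM.hasDerivAt (x := x)).const_mul C
    have h3 := (hv x hx).fun_sub h2.hasDerivWithinAt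
    rwa [hC x hx, mul_one, sub_self] at h3
  have hconst : ∀ x ∈ Icc (0 : ℝ) 1, u x - C * x = u 0 - C * (0 : ℝ) :=
    constant_of_has_deriv_right_zero (fun x hx => (hder x hx).continuousWithinAt)
      fun x hx => ((hder x (Ico_subset_Icc_self hx)).mono_of_mem_nhdsWithin
        (Icc_mem_nhdsGE_of_mem hx))
  have hC0 : C = 0 := by
    have := hconst 1 (by simp)
    simpa [h0, h1] using this
  intro x hx
  simpa [hC0, h0] using hconst x hx

/-- Since `dirichletInverse` is obtained by choice, this uniqueness is what ties it to the explicit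
`dirichletSol`. -/
theorem IsDirichletSolution.eqOn {f u w : ℝ → ℂ} (hu : IsDirichletSolution f u)
    (hw : IsDirichletSolution f w) : ∀ x ∈ Icc (0 : ℝ) 1, u x = w x := by
  have h := (hu.add (hw.const_mul (-1))).congr (g := fun _ => 0)
    (Eventually.of_forall fun x => by simp)
  intro x hx
  have := h.eq_zero x hx
  simpa [add_neg_eq_zero] using this

/-- The form that matches `dirichletSol`: the kernel of the twice iterated primitive is `max (x - y)
0`. -/
theorem green_eq (x y : ℝ) : green x y = x * (1 - y) - max (x - y) 0 := by
  unfold green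
  split_ifs with h
  · rw [max_eq_right (by linarith), sub_zero]
  · rw [max_eq_left (by linarith)]
    ring

theorem integral_prim {f : ℝ → ℂ} (hf : Integrable f μ01) {x : ℝ} (hx : x ∈ Icc (0 : ℝ) 1) :
    ∫ t in (0 : ℝ)..x, prim f t = ∫ y, (max (x - y) 0 : ℝ) * f y ∂μ01 := by
  have hprim : ∀ t ∈ Icc (0 : ℝ) 1, prim f t = ∫ y, (Iic t).indicator f y ∂μ01 := fun t ht => by
    rw [prim, intervalIntegral.integral_of_le ht.1, ← integral_indicator measurableSet_Ioc,
      ← integral_indicator measurableSet_Ioo]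
    refine integral_congr_ae ?_
    filter_upwards with y
    by_cases h1 : y ∈ Ioo (0 : ℝ) 1
    · by_cases h2 : y ≤ t
      · simp [h1.1, h1.2, h2]
      · simp [h2, indicator_apply]
    · simp [indicator_of_notMem h1, indicator_apply]
  have h1 : ∫ t in (0 : ℝ)..x, prim f t = ∫ t in Ioc 0 x, ∫ y, (Iic t).indicator f y ∂μ01 := by
    rw [intervalIntegral.integral_of_le hx.1]
    exact setIntegral_congr_fun measurableSet_Ioc fun t ht => hprim t ⟨ht.1.le, ht.2.trans hx.2⟩
  have hint : Integrable (Function.uncurry fun t y : ℝ => (Iic t).indicator f y)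
      ((volume.restrict (Ioc 0 x)).prod μ01) := by
    have h2 : Integrable (fun p : ℝ × ℝ => f p.2) ((volume.restrict (Ioc 0 x)).prod μ01) :=
      hf.comp_snd _
    have h3 : MeasurableSet {p : ℝ × ℝ | p.2 ≤ p.1} := measurableSet_le measurable_snd measurable_fst
    refine (h2.indicator h3).congr (Eventually.of_forall fun p => ?_)
    simp [Function.uncurry, indicator_apply]
  rw [h1, integral_integral_swap hint]
  refine integral_congr_ae ?_
  filter_upwards [ae_restrict_mem measurableSet_Ioo] with y hy
  have h4 : ∀ t, (Iic t).indicator f y = (Ici y).indicator (fun _ => f y) t := fun t => by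
    simp [indicator_apply]
  simp only [h4]
  rw [integral_indicator measurableSet_Ici, Measure.restrict_restrict measurableSet_Ici,
    setIntegral_const]
  have h5 : Ici y ∩ Ioc 0 x = Icc y x := by
    ext t
    simp only [mem_inter_iff, mem_Ici, mem_Ioc, mem_Icc]
    exact ⟨fun h => ⟨h.1, h.2.2⟩, fun h => ⟨h.1, hy.1.trans_le h.1, h.2⟩⟩
  rw [h5, Measure.real, Real.volume_Icc, ENNReal.toReal_ofReal', Complex.real_smul]

theorem integrable_mul_of_continuous {f : ℝ → ℂ} (hf : Integrable f μ01) {a : ℝ → ℝ}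
    (ha : Continuous a) : Integrable (fun y => (a y : ℂ) * f y) μ01 := by
  obtain ⟨C, hC⟩ := isCompact_Icc.exists_bound_of_continuousOn (s := Icc (0 : ℝ) 1) ha.continuousOn
  refine hf.bdd_mul (c := C) (Complex.continuous_ofReal.comp ha).aestronglyMeasurable ?_
  filter_upwards [ae_restrict_mem measurableSet_Ioo] with y hy
  simpa using hC y (Ioo_subset_Icc_self hy)

theorem dirichletSol_eq_integral_green {f : ℝ → ℂ} (hf : Integrable f μ01) {x : ℝ}
    (hx : x ∈ Icc (0 : ℝ) 1) : dirichletSol f x = ∫ y, (green x y : ℂ) * f y ∂μ01 := by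
  rw [dirichletSol, integral_prim hf hx, integral_prim hf (right_mem_Icc.2 zero_le_one),
    ← integral_const_mul, ← integral_sub]
  · refine integral_congr_ae ?_
    filter_upwards [ae_restrict_mem measurableSet_Ioo] with y hy
    rw [green_eq, max_eq_left (by linarith [hy.2] : (0 : ℝ) ≤ 1 - y)]
    push_cast
    ring
  · exact (integrable_mul_of_continuous hf (by fun_prop)).const_mul _
  · exact integrable_mul_of_continuous hf (by fun_prop)

theorem dirichletInverse_eq_dirichletSol (f : L2) :
    dirichletInverse f =ᵐ[μ01] dirichletSol f := by
  obtain ⟨u, hu, hfu⟩ := dirichletInverse_spec f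
  filter_upwards [hfu, ae_restrict_mem measurableSet_Ioo] with x hx hxm
  rw [hx, hu.eqOn (isDirichletSolution_dirichletSol (integrable_L2 f)) x
    (Ioo_subset_Icc_self hxm)]

theorem dirichletInverse_eq_integral_green (f : L2) :
    dirichletInverse f =ᵐ[μ01] fun x => ∫ y, (green x y : ℂ) * f y ∂μ01 := by
  filter_upwards [dirichletInverse_eq_dirichletSol f, ae_restrict_mem measurableSet_Ioo] with x hx hxm
  rw [hx, dirichletSol_eq_integral_green (integrable_L2 f) (Ioo_subset_Icc_self hxm)]

theorem eqOn_zero_of_ae_eq_zero {u : ℝ → ℂ} (hu : Continuous u) (h : u =ᵐ[μ01] 0) :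
    ∀ x ∈ Ioo (0 : ℝ) 1, u x = 0 := by
  intro x hx
  exact Measure.eqOn_open_of_ae_eq h isOpen_Ioo hu.continuousOn continuousOn_const hx

theorem continuous_dirichletSol {f : ℝ → ℂ} (hf : Integrable f μ01) :
    Continuous (dirichletSol f) :=
  continuous_iff_continuousAt.2 fun x => (hasDerivAt_dirichletSol hf x).continuousAt

/-- If the solution vanishes, so does its derivative; hence `prim f` is constant and Lebesgue
differentiation gives `f = 0`. -/
theorem dirichletInverse_injective : Function.Injective dirichletInverse := by
  rw [injective_iff_map_eq_zero]
  intro f hf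
  have hi := integrable_L2 f
  have h1 : dirichletSol f =ᵐ[μ01] 0 := by
    refine (dirichletInverse_eq_dirichletSol f).symm.trans ?_
    rw [hf]
    exact Lp.coeFn_zero _ _ _
  have h2 := eqOn_zero_of_ae_eq_zero (continuous_dirichletSol hi) h1
  set c := ∫ t in (0 : ℝ)..1, prim f t
  have h3 : ∀ x ∈ Ioo (0 : ℝ) 1, prim f x = c := fun x hx => by
    have h4 := hasDerivAt_dirichletSol hi x
    have h5 : HasDerivAt (dirichletSol f) 0 x := by
      refine (hasDerivAt_const x (0 : ℂ)).congr_of_eventuallyEq ?_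
      filter_upwards [isOpen_Ioo.mem_nhds hx] with y hy using h2 y hy
    exact (sub_eq_zero.1 (h4.unique h5)).symm
  have h := LocallyIntegrable.ae_hasDerivAt_integral (integrable_ind hi).locallyIntegrable
  refine Lp.ext ?_
  filter_upwards [ae_restrict_of_ae h, ae_restrict_mem measurableSet_Ioo,
    Lp.coeFn_zero ℂ 2 μ01] with x hx hxm hx0
  have h6 : HasDerivAt (prim f) (f x) x := by
    have := hx 0
    rwa [indicator_of_mem hxm] at this
  have h7 : HasDerivAt (prim f) 0 x := by
    refine (hasDerivAt_const x c).congr_of_eventuallyEq ?_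
    filter_upwards [isOpen_Ioo.mem_nhds hxm] with y hy using h3 y hy
  rw [h6.unique h7, hx0]
  rfl

end Dirichlet

/-! ### The sine basis and the sine series of the Green's function. -/

section Sine

theorem continuous_phi (n : ℕ+) : Continuous (phi n) := by
  unfold phi
  fun_prop

theorem abs_phi_le (n : ℕ+) (x : ℝ) : |phi n x| ≤ √2 := by
  rw [phi, abs_mul, abs_of_nonneg (Real.sqrt_nonneg 2)]
  exact mul_le_of_le_one_right (Real.sqrt_nonneg 2) (Real.abs_sin_le_one _)

theorem abs_phi_mul_phi_le (i j : ℕ+) (x y : ℝ) : |phi i x * phi j y| ≤ 2 := by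
  rw [abs_mul, ← Real.mul_self_sqrt (zero_le_two (α := ℝ))]
  exact mul_le_mul (abs_phi_le i x) (abs_phi_le j y) (abs_nonneg _) (Real.sqrt_nonneg 2)

theorem phi_mul_phi (i j : ℕ+) (x y : ℝ) :
    phi i x * phi j y =
      Real.cos (i * Real.pi * x - j * Real.pi * y) -
        Real.cos (i * Real.pi * x + j * Real.pi * y) := by
  rw [Real.cos_sub, Real.cos_add, phi, phi, mul_mul_mul_comm, Real.mul_self_sqrt zero_le_two]
  ring

theorem summable_inv_sq_mul_pi_sq : Summable fun n : ℕ+ => ((n : ℝ) ^ 2 * Real.pi ^ 2)⁻¹ := by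
  have h : Summable fun n : ℕ => ((n : ℝ) ^ 2)⁻¹ := Real.summable_nat_pow_inv.2 one_lt_two
  have h1 := (h.comp_injective PNat.coe_injective).mul_right (Real.pi ^ 2)⁻¹
  exact h1.congr fun n => (mul_inv _ _).symm

/-- This is the Fourier series of the Bernoulli polynomial `B₂(t) = t² - t + 1/6`. -/
theorem hasSum_cos_div_sq {t : ℝ} (ht : t ∈ Icc (0 : ℝ) 1) :
    HasSum (fun n : ℕ+ => ((n : ℝ) ^ 2 * Real.pi ^ 2)⁻¹ * Real.cos (2 * Real.pi * n * t))
      (t ^ 2 - t + 6⁻¹) := by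
  have h := hasSum_one_div_nat_pow_mul_cos one_ne_zero ht
  have h1 := (PNat.coe_injective.hasSum_iff fun n hn => by
    have : n = 0 := by
      by_contra h0
      exact hn ⟨⟨n, Nat.pos_of_ne_zero h0⟩, rfl⟩
    simp [this]).2 h
  have h2 := h1.mul_left (Real.pi ^ 2)⁻¹
  have hB : (Polynomial.map (algebraMap ℚ ℝ) (Polynomial.bernoulli (2 * 1))).eval t =
      t ^ 2 - t + 6⁻¹ := bernoulliFun_two t
  rw [hB] at h2
  convert! h2 using 1
  · funext n
    simp only [Function.comp_apply, mul_inv, mul_one]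
    ring
  · have := Real.pi_ne_zero
    simp only [Nat.factorial]
    field_simp
    norm_num
    ring

theorem hasSum_green {x y : ℝ} (hx : x ∈ Icc (0 : ℝ) 1) (hy : y ∈ Icc (0 : ℝ) 1) :
    HasSum (fun n : ℕ+ => ((n : ℝ) ^ 2 * Real.pi ^ 2)⁻¹ * phi n x * phi n y) (green x y) := by
  -- The product of sines is a difference of cosines at `nπ(x - y)` and `nπ(x + y)`; halving fits
  -- the period of `cos (2πnt)`, and the absolute value keeps `t` in `[0,1]`.
  have h1 := hasSum_cos_div_sq (t := |x - y| / 2)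
    ⟨by positivity, by 
      linarith [(abs_le.2 ⟨by linarith [hx.1, hy.2], by linarith [hx.2, hy.1]⟩ :
        |x - y| ≤ 1)]⟩
  have h2 := hasSum_cos_div_sq (t := (x + y) / 2)
    ⟨by linarith [hx.1, hy.1], by linarith [hx.2, hy.2]⟩
  convert! h1.sub h2 using 1
  · funext n
    have e1 : Real.cos (2 * Real.pi * n * (|x - y| / 2)) =
        Real.cos (n * Real.pi * x - n * Real.pi * y) := by
      rw [← Real.cos_abs (n * Real.pi * x - n * Real.pi * y), ← mul_sub, abs_mul,
        abs_of_nonneg (by positivity : (0 : ℝ) ≤ n * Real.pi)]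
      congr 1
      ring
    have e2 : Real.cos (2 * Real.pi * n * ((x + y) / 2)) =
        Real.cos (n * Real.pi * x + n * Real.pi * y) := by
      congr 1
      ring
    rw [mul_assoc, phi_mul_phi, e1, e2, mul_sub]
  · unfold green
    split_ifs with h
    · rw [abs_of_nonpos (by linarith)]
      ring
    · rw [abs_of_nonneg (by linarith)]
      ring

theorem norm_sine_term_le (n : ℕ+) (x y : ℝ) :
    ‖((n : ℝ) ^ 2 * Real.pi ^ 2)⁻¹ * phi n x * phi n y‖ ≤ ((n : ℝ) ^ 2 * Real.pi ^ 2)⁻¹ * 2 := by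
  rw [mul_assoc, norm_mul, Real.norm_of_nonneg (by positivity)]
  gcongr
  exact abs_phi_mul_phi_le n n x y

theorem tendstoUniformlyOn_green :
    TendstoUniformlyOn
      (fun (N : Finset ℕ+) (p : ℝ × ℝ) =>
        ∑ n ∈ N, ((n : ℝ) ^ 2 * Real.pi ^ 2)⁻¹ * phi n p.1 * phi n p.2)
      (fun p => green p.1 p.2) atTop (Icc (0 : ℝ) 1 ×ˢ Icc (0 : ℝ) 1) := by
  refine (tendstoUniformlyOn_tsum (summable_inv_sq_mul_pi_sq.mul_right 2)
    fun n p _ => norm_sine_term_le n p.1 p.2).congr_right fun p hp => ?_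
  exact (hasSum_green hp.1 hp.2).tsum_eq

theorem integral_cos_int_mul_pi {k : ℤ} (hk : k ≠ 0) :
    ∫ x in (0 : ℝ)..1, Real.cos (k * Real.pi * x) = 0 := by
  have h0 : (k : ℝ) * Real.pi ≠ 0 := by
    have : (k : ℝ) ≠ 0 := by exact_mod_cast hk
    have := Real.pi_ne_zero
    positivity
  rw [intervalIntegral.integral_comp_mul_left (fun x => Real.cos x) h0, integral_cos]
  simp

theorem integral_phi_mul_phi (i j : ℕ+) :
    ∫ x, phi i x * phi j x ∂μ01 = if i = j then 1 else 0 := by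
  rw [← integral_Ioc_eq_integral_Ioo, ← intervalIntegral.integral_of_le zero_le_one]
  have h1 : ∀ x, phi i x * phi j x = Real.cos (((i : ℤ) - (j : ℤ) : ℤ) * Real.pi * x) -
      Real.cos (((i : ℤ) + (j : ℤ) : ℤ) * Real.pi * x) := fun x => by
    rw [phi_mul_phi]
    push_cast
    ring_nf
  simp only [h1]
  rw [intervalIntegral.integral_sub
    (Continuous.intervalIntegrable (by fun_prop) _ _)
    (Continuous.intervalIntegrable (by fun_prop) _ _)]
  have hi := i.pos
  have hj := j.pos
  rw [integral_cos_int_mul_pi (k := (i : ℤ) + (j : ℤ)) (by positivity), sub_zero]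
  split_ifs with h
  · simp [h]
  · refine integral_cos_int_mul_pi (sub_ne_zero.2 fun h2 => h ?_)
    exact PNat.coe_injective (by exact_mod_cast h2)

theorem memLp_phi (n : ℕ+) : MemLp (fun x => (phi n x : ℂ)) 2 μ01 :=
  MemLp.of_bound (Complex.continuous_ofReal.comp (continuous_phi n)).aestronglyMeasurable (√2)
    (Eventually.of_forall fun x => by simpa using abs_phi_le n x)

/-- The functions `φ_n` as elements of `L²(0,1)`. -/
def phiL2 (n : ℕ+) : L2 := (memLp_phi n).toLp _

theorem coeFn_phiL2 (n : ℕ+) : phiL2 n =ᵐ[μ01] fun x => (phi n x : ℂ) := (memLp_phi n).coeFn_toLp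

theorem inner_phiL2 (n : ℕ+) (f : L2) : ⟪phiL2 n, f⟫_ℂ = ∫ x, (phi n x : ℂ) * f x ∂μ01 := by
  rw [L2.inner_def]
  refine integral_congr_ae ?_
  filter_upwards [coeFn_phiL2 n] with x hx
  rw [hx, RCLike.inner_apply, mul_comm]
  simp

theorem orthonormal_phiL2 : Orthonormal ℂ phiL2 := by
  rw [orthonormal_iff_ite]
  intro i j
  rw [inner_phiL2]
  have h1 : ∫ x, (phi i x : ℂ) * phiL2 j x ∂μ01 = ∫ x, ((phi i x * phi j x : ℝ) : ℂ) ∂μ01 := by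
    refine integral_congr_ae ?_
    filter_upwards [coeFn_phiL2 j] with x hx
    rw [hx]
    push_cast
    rfl
  have h2 : ∫ x, ((phi i x * phi j x : ℝ) : ℂ) ∂μ01 =
      ((∫ x, phi i x * phi j x ∂μ01 : ℝ) : ℂ) := integral_ofReal
  rw [h1, h2, integral_phi_mul_phi]
  split_ifs <;> simp

theorem hasSum_dirichletSol {f : ℝ → ℂ} (hf : Integrable f μ01) {x : ℝ} (hx : x ∈ Icc (0 : ℝ) 1) :
    HasSum (fun n : ℕ+ => (((n : ℝ) ^ 2 * Real.pi ^ 2)⁻¹ * phi n x : ℝ) *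
      ∫ y, (phi n y : ℂ) * f y ∂μ01) (dirichletSol f x) := by
  have hint : ∀ n : ℕ+, Integrable
      (fun y => ((((n : ℝ) ^ 2 * Real.pi ^ 2)⁻¹ * phi n x * phi n y : ℝ) : ℂ) * f y) μ01 :=
    fun n => integrable_mul_of_continuous hf (continuous_const.mul (continuous_phi n))
  have h := hasSum_integral_of_summable_integral_norm hint ?_
  · rw [dirichletSol_eq_integral_green hf hx]
    convert! h using 1
    · funext n
      rw [← integral_const_mul]
      congr 1
      funext y
      push_cast
      ring
    · refine integral_congr_ae ?_
      filter_upwards [ae_restrict_mem measurableSet_Ioo] with y hy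
      have h1 := (Complex.hasSum_ofReal (L := .unconditional _)).2
        (hasSum_green hx (Ioo_subset_Icc_self hy))
      exact (h1.mul_right (f y)).tsum_eq.symm
  · refine Summable.of_nonneg_of_le (fun n => integral_nonneg fun _ => norm_nonneg _) (fun n => ?_)
      ((summable_inv_sq_mul_pi_sq.mul_right 2).mul_right (∫ y, ‖f y‖ ∂μ01))
    rw [← integral_const_mul]
    refine integral_mono (hint n).norm (hf.norm.const_mul _) fun y => ?_
    rw [norm_mul, Complex.norm_real]
    refine mul_le_mul_of_nonneg_right ?_ (norm_nonneg _)
    exact norm_sine_term_le n x y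

/-- If all sine coefficients of `f` vanish, the series for `dirichletSol f` is zero, and injectivity
forces `f = 0`. -/
theorem orthogonal_span_phiL2 : (Submodule.span ℂ (range phiL2))ᗮ = ⊥ := by
  rw [eq_bot_iff]
  intro f hf
  rw [Submodule.mem_orthogonal] at hf
  refine (Submodule.mem_bot ℂ).2 (dirichletInverse_injective ?_)
  rw [map_zero]
  refine Lp.ext ((dirichletInverse_eq_dirichletSol f).trans ?_)
  filter_upwards [Lp.coeFn_zero ℂ 2 μ01, ae_restrict_mem measurableSet_Ioo] with x hx hxm
  rw [hx]
  refine (hasSum_dirichletSol (integrable_L2 f) (Ioo_subset_Icc_self hxm)).unique ?_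
  simp only [← inner_phiL2, hf _ (Submodule.subset_span (mem_range_self _)), mul_zero]
  exact hasSum_zero

/-- The orthonormal basis `φ_n` of `L²(0,1)`. -/
def sineBasis : HilbertBasis ℕ+ ℂ L2 :=
  HilbertBasis.mkOfOrthogonalEqBot orthonormal_phiL2 orthogonal_span_phiL2

theorem sineBasis_apply (n : ℕ+) : sineBasis n = phiL2 n :=
  congrFun (HilbertBasis.coe_mkOfOrthogonalEqBot _ _) n

theorem hasDerivAt_phi (n : ℕ+) (x : ℝ) :
    HasDerivAt (phi n) (√2 * (Real.cos (n * Real.pi * x) * (n * Real.pi))) x := by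
  have h : HasDerivAt (fun x : ℝ => (n : ℝ) * Real.pi * x) (n * Real.pi * 1) x :=
    (hasDerivAt_id x).const_mul _
  rw [mul_one] at h
  exact h.sin.const_mul _

theorem isDirichletSolution_phi (n : ℕ+) :
    IsDirichletSolution (fun x => (phi n x : ℂ))
      (fun x => ((((n : ℝ) * Real.pi) ^ 2)⁻¹ * phi n x : ℝ)) := by
  have hn : (n : ℝ) * Real.pi ≠ 0 := by positivity
  refine ⟨by simp [phi], by simp [phi], fun x =>
    ((((n : ℝ) * Real.pi) ^ 2)⁻¹ * (√2 * (Real.cos (n * Real.pi * x) * (n * Real.pi))) : ℝ),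
    fun x _ => (((hasDerivAt_phi n x).const_mul _).ofReal_comp).hasDerivWithinAt, ?_,
    Eventually.of_forall fun x => ?_⟩
  · refine (ContDiff.contDiffOn (n := 1) ?_).absolutelyContinuousOnInterval
    have h : ContDiff ℝ 1 fun x : ℝ =>
      (((n : ℝ) * Real.pi) ^ 2)⁻¹ * (√2 * (Real.cos (n * Real.pi * x) * (n * Real.pi))) := by
      fun_prop
    exact Complex.ofRealCLM.contDiff.comp h
  · have h : HasDerivAt (fun x : ℝ => (n : ℝ) * Real.pi * x) (n * Real.pi * 1) x :=
      (hasDerivAt_id x).const_mul _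
    have h1 := (((h.cos.mul_const (n * Real.pi)).const_mul (√2)).const_mul
      (((n : ℝ) * Real.pi) ^ 2)⁻¹).ofReal_comp
    convert! h1 using 1
    simp only [phi]
    push_cast
    have hn' : (n : ℂ) * (Real.pi : ℂ) ≠ 0 := by exact_mod_cast hn
    field_simp

theorem dirichletInverse_phiL2 (n : ℕ+) :
    dirichletInverse (phiL2 n) = ((((n : ℝ) * Real.pi)⁻¹ : ℝ) : ℂ) ^ 2 • phiL2 n := by
  refine Lp.ext ?_
  filter_upwards [dirichletInverse_eq_dirichletSol (phiL2 n), Lp.coeFn_smul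
    (((((n : ℝ) * Real.pi)⁻¹ : ℝ) : ℂ) ^ 2) (phiL2 n), coeFn_phiL2 n,
    ae_restrict_mem measurableSet_Ioo] with x h1 h2 h3 hx
  rw [h1, h2, Pi.smul_apply, h3, dirichletSol_congr (coeFn_phiL2 n),
    (isDirichletSolution_dirichletSol ((memLp_phi n).integrable (by norm_num))).eqOn
      (isDirichletSolution_phi n) x (Ioo_subset_Icc_self hx)]
  simp [mul_pow]

end Sine

/-! ### Symmetrization, traces and eigenvalue sequences. -/

section Operators

theorem nonneg_of_eigenbasis {H : Type} [NormedAddCommGroup H] [InnerProductSpace ℂ H]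
    [CompleteSpace H] {ι : Type} (e : HilbertBasis ι ℂ H) {T : H →L[ℂ] H} {m : ι → ℝ}
    (hm : ∀ k, 0 ≤ m k) (hT : ∀ k, T (e k) = (m k : ℂ) • e k) : 0 ≤ T := by
  have h : ∀ x y, HasSum (fun k => (m k : ℂ) * (⟪x, e k⟫_ℂ * ⟪e k, y⟫_ℂ)) ⟪x, T y⟫_ℂ := by
    intro x y
    refine (((e.hasSum_repr y).mapL T).mapL (innerSL ℂ x)).congr_fun fun k => ?_
    rw [map_smul, hT, e.repr_apply_apply, map_smul, map_smul, innerSL_apply_apply, smul_eq_mul,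
      smul_eq_mul]
    ring
  rw [ContinuousLinearMap.nonneg_iff_isPositive]
  refine ⟨fun x y => ?_, fun x => ?_⟩
  · change ⟪T x, y⟫_ℂ = ⟪x, T y⟫_ℂ
    have h1 := (h y x).star
    rw [← starRingEnd_apply, inner_conj_symm] at h1
    refine h1.unique ((h x y).congr_fun fun k => ?_)
    simp only [← starRingEnd_apply, map_mul, inner_conj_symm, Complex.conj_ofReal]
    ring
  · rw [ContinuousLinearMap.reApplyInnerSelf_apply, ← inner_re_symm]
    refine ((h x x).mapL Complex.reCLM).nonneg fun k => ?_
    rw [← inner_conj_symm x (e k), RCLike.conj_mul]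
    have : (m k : ℂ) * (((‖⟪e k, x⟫_ℂ‖ : ℝ) : ℂ)) ^ 2 = ((m k * ‖⟪e k, x⟫_ℂ‖ ^ 2 : ℝ) : ℂ) := by
      push_cast
      rfl
    have h2 : Complex.reCLM ((m k : ℂ) * (((‖⟪e k, x⟫_ℂ‖ : ℝ) : ℂ)) ^ 2) =
        m k * ‖⟪e k, x⟫_ℂ‖ ^ 2 := by
      rw [this]
      exact Complex.ofReal_re _
    exact (mul_nonneg (hm k) (sq_nonneg _)).trans_eq h2.symm

theorem dirichletInverse_nonneg : 0 ≤ dirichletInverse := by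
  refine nonneg_of_eigenbasis sineBasis (m := fun n => (((n : ℝ) * Real.pi)⁻¹) ^ 2)
    (fun n => sq_nonneg _) fun n => ?_
  rw [sineBasis_apply, dirichletInverse_phiL2, Complex.ofReal_pow]

/-- The positive square root of `(-Δ_D)⁻¹`. -/
def dirichletSqrt : L2 →L[ℂ] L2 := (exists_nonneg_mul_self_eq dirichletInverse_nonneg).choose

theorem dirichletSqrt_mul_self : dirichletSqrt * dirichletSqrt = dirichletInverse :=
  (exists_nonneg_mul_self_eq dirichletInverse_nonneg).choose_spec.2

theorem dirichletSqrt_nonneg : 0 ≤ dirichletSqrt :=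
  (exists_nonneg_mul_self_eq dirichletInverse_nonneg).choose_spec.1

theorem dirichletSqrt_isSymmetric : dirichletSqrt.IsSymmetric :=
  ((ContinuousLinearMap.nonneg_iff_isPositive _).1 dirichletSqrt_nonneg).isSymmetric

theorem dirichletSqrt_apply_apply (f : L2) :
    dirichletSqrt (dirichletSqrt f) = dirichletInverse f :=
  DFunLike.congr_fun dirichletSqrt_mul_self f

theorem dirichletSqrt_phiL2 (n : ℕ+) :
    dirichletSqrt (phiL2 n) = ((((n : ℝ) * Real.pi)⁻¹ : ℝ) : ℂ) • phiL2 n := by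
  refine eigenvector_of_sq dirichletSqrt_nonneg (by positivity) ?_
  rw [dirichletSqrt_apply_apply, dirichletInverse_phiL2]

theorem dirichletSqrt_injective : Function.Injective dirichletSqrt := fun f g h =>
  dirichletInverse_injective (by
    rw [← dirichletSqrt_apply_apply, h, dirichletSqrt_apply_apply])

theorem isHilbertSchmidt_dirichletSqrt : IsHilbertSchmidt dirichletSqrt := by
  refine isHilbertSchmidt_of_summable sineBasis (summable_inv_sq_mul_pi_sq.congr fun n => ?_)
  rw [sineBasis_apply, dirichletSqrt_phiL2, norm_smul, orthonormal_phiL2.1 n, mul_one,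
    Complex.norm_real, norm_inv, inv_pow, Real.norm_of_nonneg (by positivity), mul_pow]

variable {ρ : ℝ → ℝ} (hρ : MemLp ρ ∞ μ01)

theorem inner_mulOperator (f g : L2) :
    ⟪f, mulOperator ρ hρ g⟫_ℂ = ∫ x, (ρ x : ℂ) * ⟪f x, g x⟫_ℂ ∂μ01 := by
  rw [L2.inner_def]
  refine integral_congr_ae ?_
  filter_upwards [mulOperator_apply ρ hρ g] with x hx
  rw [hx, ← smul_eq_mul, inner_smul_right]

theorem mulOperator_nonneg (hpos : ∀ᵐ x ∂μ01, 0 < ρ x) : 0 ≤ mulOperator ρ hρ := by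
  rw [ContinuousLinearMap.nonneg_iff_isPositive]
  refine ⟨fun f g => ?_, fun f => ?_⟩
  · change ⟪mulOperator ρ hρ f, g⟫_ℂ = ⟪f, mulOperator ρ hρ g⟫_ℂ
    rw [← inner_conj_symm, inner_mulOperator, inner_mulOperator, ← integral_conj]
    refine integral_congr_ae (Eventually.of_forall fun x => ?_)
    simp only [map_mul, inner_conj_symm, Complex.conj_ofReal]
  · rw [ContinuousLinearMap.reApplyInnerSelf_apply, ← inner_re_symm, inner_mulOperator]
    have h1 : ∀ x, (ρ x : ℂ) * ⟪f x, f x⟫_ℂ = ((ρ x * ‖f x‖ ^ 2 : ℝ) : ℂ) := fun x => by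
      rw [inner_self_eq_norm_sq_to_K]
      push_cast
      rfl
    simp only [h1]
    have h2 : ∫ x, ((ρ x * ‖f x‖ ^ 2 : ℝ) : ℂ) ∂μ01 = ((∫ x, ρ x * ‖f x‖ ^ 2 ∂μ01 : ℝ) : ℂ) :=
      integral_ofReal
    rw [h2]
    refine (integral_nonneg_of_ae ?_).trans_eq (Complex.ofReal_re _).symm
    filter_upwards [hpos] with x hx
    exact mul_nonneg hx.le (sq_nonneg _)

theorem mulOperator_injective (hpos : ∀ᵐ x ∂μ01, 0 < ρ x) :
    Function.Injective (mulOperator ρ hρ) := by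
  rw [injective_iff_map_eq_zero]
  intro f hf
  refine Lp.ext ?_
  have h := mulOperator_apply ρ hρ f
  rw [hf] at h
  filter_upwards [h, hpos, Lp.coeFn_zero ℂ 2 μ01] with x h1 h2 h3
  rw [h3] at h1 ⊢
  have h4 : (ρ x : ℂ) * f x = 0 := h1.symm
  exact (mul_eq_zero.1 h4).resolve_left (by exact_mod_cast h2.ne')

/-- The self-adjoint operator `A^{1/2} M_ρ A^{1/2}`. -/
def symmOperator : L2 →L[ℂ] L2 := dirichletSqrt * (mulOperator ρ hρ * dirichletSqrt)

theorem symmOperator_nonneg (hpos : ∀ᵐ x ∂μ01, 0 < ρ x) : 0 ≤ symmOperator hρ := by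
  rw [ContinuousLinearMap.nonneg_iff_isPositive]
  have h1 := (ContinuousLinearMap.nonneg_iff_isPositive _).1 (mulOperator_nonneg hρ hpos)
  have h2 := h1.conj_adjoint dirichletSqrt
  have h3 : ContinuousLinearMap.adjoint dirichletSqrt = dirichletSqrt :=
    dirichletSqrt_isSymmetric.isSelfAdjoint
  rwa [h3] at h2

theorem symmOperator_isSymmetric (hpos : ∀ᵐ x ∂μ01, 0 < ρ x) : (symmOperator hρ).IsSymmetric :=
  ((ContinuousLinearMap.nonneg_iff_isPositive _).1 (symmOperator_nonneg hρ hpos)).isSymmetric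

theorem symmOperator_injective (hpos : ∀ᵐ x ∂μ01, 0 < ρ x) :
    Function.Injective (symmOperator hρ) :=
  dirichletSqrt_injective.comp ((mulOperator_injective hρ hpos).comp dirichletSqrt_injective)

theorem isHilbertSchmidt_symmOperator : IsHilbertSchmidt (symmOperator hρ) :=
  isHilbertSchmidt_dirichletSqrt.comp_right _

/-- The two outer square roots contribute `1 / (i π)` and `1 / (j π)`, the prefactor of the moment
matrix. -/
theorem inner_symmOperator (i j : ℕ+) :
    ⟪phiL2 i, symmOperator hρ (phiL2 j)⟫_ℂ = momentMatrix ρ i j := by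
  have h1 : ⟪phiL2 i, symmOperator hρ (phiL2 j)⟫_ℂ =
      ⟪dirichletSqrt (phiL2 i), mulOperator ρ hρ (dirichletSqrt (phiL2 j))⟫_ℂ :=
    (dirichletSqrt_isSymmetric _ _).symm
  have h2 : ⟪phiL2 i, mulOperator ρ hρ (phiL2 j)⟫_ℂ =
      ((∫ x, phi i x * phi j x * ρ x ∂μ01 : ℝ) : ℂ) := by
    rw [inner_phiL2]
    have h3 : ∫ x, ((phi i x * phi j x * ρ x : ℝ) : ℂ) ∂μ01 =
        ((∫ x, phi i x * phi j x * ρ x ∂μ01 : ℝ) : ℂ) := integral_ofReal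
    rw [← h3]
    refine integral_congr_ae ?_
    filter_upwards [mulOperator_apply ρ hρ (phiL2 j), coeFn_phiL2 j] with x hx hx2
    rw [hx, hx2]
    push_cast
    ring
  rw [h1, dirichletSqrt_phiL2, dirichletSqrt_phiL2, map_smul, inner_smul_left, inner_smul_right,
    Complex.conj_ofReal, h2, momentMatrix, ← Complex.ofReal_mul, ← Complex.ofReal_mul]
  congr 1
  rw [← mul_assoc]
  congr 1
  rw [one_div, ← mul_inv]
  congr 1
  ring

theorem hasSum_inner_symmOperator_pow (hpos : ∀ᵐ x ∂μ01, 0 < ρ x) (n : ℕ) (i j : ℕ+) :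
    HasSum (fun k => (momentMatrix ρ i k : ℂ) * ⟪phiL2 k, (symmOperator hρ ^ n) (phiL2 j)⟫_ℂ)
      ⟪phiL2 i, (symmOperator hρ ^ (n + 1)) (phiL2 j)⟫_ℂ := by
  have h1 : ⟪phiL2 i, (symmOperator hρ ^ (n + 1)) (phiL2 j)⟫_ℂ =
      ⟪symmOperator hρ (phiL2 i), (symmOperator hρ ^ n) (phiL2 j)⟫_ℂ := by
    rw [pow_succ']
    exact (symmOperator_isSymmetric hρ hpos _ _).symm
  rw [h1]
  refine (sineBasis.hasSum_inner_mul_inner _ _).congr_fun fun k => ?_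
  rw [sineBasis_apply, ← inner_symmOperator hρ]
  congr 1
  exact (symmOperator_isSymmetric hρ hpos _ _).symm

include hρ in
theorem matrixPow_momentMatrix (hpos : ∀ᵐ x ∂μ01, 0 < ρ x) (n : ℕ) (i j : ℕ+) :
    (matrixPow (momentMatrix ρ) n i j : ℂ) = ⟪phiL2 i, (symmOperator hρ ^ n) (phiL2 j)⟫_ℂ := by
  induction n generalizing i with
  | zero =>
    have h := orthonormal_iff_ite.1 orthonormal_phiL2 i j
    rw [pow_zero]
    refine Eq.trans ?_ h.symm
    simp only [matrixPow]
    split_ifs <;> simp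
  | succ n ih =>
    rw [← (hasSum_inner_symmOperator_pow hρ hpos n i j).tsum_eq, matrixPow, Complex.ofReal_tsum]
    simp only [← ih, Complex.ofReal_mul]

include hρ in
theorem summable_matrixPow (hpos : ∀ᵐ x ∂μ01, 0 < ρ x) (n : ℕ) (i j : ℕ+) :
    Summable fun k => momentMatrix ρ i k * matrixPow (momentMatrix ρ) n k j := by
  have h := (hasSum_inner_symmOperator_pow hρ hpos n i j).summable
  simp only [← matrixPow_momentMatrix hρ hpos, ← Complex.ofReal_mul] at h
  exact Complex.summable_ofReal.1 h

theorem mul_pow_succ_comm {R : Type*} [Monoid R] (a b : R) (n : ℕ) :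
    (a * b) ^ (n + 1) = a * ((b * a) ^ n * b) := by
  induction n with
  | zero => simp
  | succ n ih =>
    rw [pow_succ, ih, pow_succ]
    simp only [mul_assoc]

/-- The operator `(A ∘ M_ρ)^s` is of trace class, and its trace is that of `(A^{1/2} M_ρ A^{1/2})^s`
and that of the `s`-th power of the moment matrix. -/
theorem exists_trace (hpos : ∀ᵐ x ∂μ01, 0 < ρ x) {s : ℕ} (hs : 1 ≤ s) :
    ∃ τ : ℝ, HasTrace ((dirichletInverse ∘L mulOperator ρ hρ) ^ s) (τ : ℂ) ∧
      (∀ (ι : Type) (e : HilbertBasis ι ℂ L2),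
        HasSum (fun k => ⟪e k, (symmOperator hρ ^ s) (e k)⟫_ℂ) (τ : ℂ)) ∧
      HasMatrixPowTrace (momentMatrix ρ) s τ := by
  obtain ⟨n, rfl⟩ := Nat.exists_eq_add_of_le' hs
  set S := dirichletSqrt with hS
  set M := mulOperator ρ hρ with hM
  have hT : symmOperator hρ = S * (M * S) := rfl
  have hT' : symmOperator hρ = (S * M) * S := by rw [hT, mul_assoc]
  -- Chosen so that the two operator powers are `S * Z` and `Z * S`, with both factors
  -- Hilbert-Schmidt.
  set Z : L2 →L[ℂ] L2 := symmOperator hρ ^ n * (S * M) with hZ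
  have hK : (dirichletInverse ∘L M) ^ (n + 1) = S * Z := by
    have : dirichletInverse ∘L M = S * (S * M) := by
      rw [← mul_assoc, hS, dirichletSqrt_mul_self]
      rfl
    rw [this, mul_pow_succ_comm, ← hT']
  have hTs : symmOperator hρ ^ (n + 1) = Z * S := by
    rw [pow_succ, hZ, mul_assoc, ← hT']
  have hSHS : IsHilbertSchmidt S := isHilbertSchmidt_dirichletSqrt
  have hZHS : IsHilbertSchmidt Z := (hSHS.comp_right M).comp_left _
  obtain ⟨t, -, ht⟩ := hSHS.exists_hasSum_inner_mul hZHS sineBasis sineBasis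
  have hdiag : HasSum (fun i => (matrixPow (momentMatrix ρ) (n + 1) i i : ℂ)) t := by
    refine ht.congr_fun fun i => ?_
    rw [matrixPow_momentMatrix hρ hpos, hTs, sineBasis_apply]
  -- The diagonal entries in the sine basis are real, hence so is the trace.
  obtain ⟨τ, hτ⟩ := Complex.summable_ofReal.1 hdiag.summable
  have htτ : t = τ := hdiag.unique (Complex.hasSum_ofReal.2 hτ)
  rw [htτ] at ht
  have hKtr : ∀ (ι : Type) (e : HilbertBasis ι ℂ L2),
      HasSum (fun k => ⟪e k, (S * Z) (e k)⟫_ℂ) (τ : ℂ) := fun ι e => by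
    obtain ⟨t', h1, h2⟩ := hSHS.exists_hasSum_inner_mul hZHS e sineBasis
    rwa [h2.unique ht] at h1
  refine ⟨τ, ⟨?_, ?_⟩, ?_, fun m _ i j => summable_matrixPow hρ hpos m i j, hτ⟩
  · rw [hK]
    exact hSHS.isTraceClass_mul hZHS
  · rw [hK]
    exact hKtr
  · intro ι e
    rw [hTs]
    obtain ⟨t', h1, h2⟩ := hSHS.exists_hasSum_inner_mul hZHS sineBasis e
    rwa [h1.unique (hKtr _ sineBasis)] at h2

theorem eigenspace_zero (ρ : ℝ → ℝ) : eigenspace ρ 0 = ⊥ := by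
  rw [eq_bot_iff]
  rintro w ⟨u, hu, hwu⟩
  have h := (hu.congr (g := fun _ => 0) (Eventually.of_forall fun x => by simp)).eq_zero
  refine (Submodule.mem_bot ℂ).2 (Lp.ext ?_)
  filter_upwards [hwu, Lp.coeFn_zero ℂ 2 μ01, ae_restrict_mem measurableSet_Ioo] with x h1 h2 h3
  rw [h1, h2, h x (Ioo_subset_Icc_self h3)]
  rfl

theorem coeFn_smul_mulOperator {z : ℂ} {w : L2} {u : ℝ → ℂ} (hwu : w =ᵐ[μ01] u) :
    (z • mulOperator ρ hρ w : L2) =ᵐ[μ01] fun x => z * ρ x * u x := by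
  filter_upwards [Lp.coeFn_smul z (mulOperator ρ hρ w), mulOperator_apply ρ hρ w, hwu]
    with x h1 h2 h3
  rw [h1, Pi.smul_apply, h2, h3, smul_eq_mul, mul_assoc]

/-- By uniqueness, `-u'' = z ρ u` with Dirichlet conditions is the same as `u = A (z ρ u)`. -/
theorem eigenspace_eq {z : ℂ} (hz : z ≠ 0) :
    eigenspace ρ z = Module.End.eigenspace
      ((dirichletInverse * mulOperator ρ hρ : L2 →L[ℂ] L2) : Module.End ℂ L2) z⁻¹ := by
  have key : ∀ w : L2, w ∈ Module.End.eigenspace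
      ((dirichletInverse * mulOperator ρ hρ : L2 →L[ℂ] L2) : Module.End ℂ L2) z⁻¹ ↔
      dirichletInverse (z • mulOperator ρ hρ w) = w := fun w => by
    rw [Module.End.mem_eigenspace_iff, map_smul]
    change dirichletInverse (mulOperator ρ hρ w) = z⁻¹ • w ↔ _
    constructor
    · intro h
      rw [h, smul_inv_smul₀ hz]
    · intro h
      rw [eq_inv_smul_iff₀ hz, h]
  ext w
  rw [key]
  constructor
  · rintro ⟨u, hu, hwu⟩
    have h1 := hu.congr (coeFn_smul_mulOperator hρ (z := z) hwu).symm
    refine Lp.ext ?_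
    filter_upwards [dirichletInverse_eq_dirichletSol (z • mulOperator ρ hρ w), hwu,
      ae_restrict_mem measurableSet_Ioo] with x h2 h3 h4
    rw [h2, h3, (isDirichletSolution_dirichletSol (integrable_L2 _)).eqOn h1 x
      (Ioo_subset_Icc_self h4)]
  · intro h
    have hwu : w =ᵐ[μ01] dirichletSol (z • mulOperator ρ hρ w : L2) := by
      conv_lhs => rw [← h]
      exact dirichletInverse_eq_dirichletSol _
    exact ⟨_, (isDirichletSolution_dirichletSol (integrable_L2 _)).congr
      (coeFn_smul_mulOperator hρ hwu), hwu⟩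

theorem rank_eigenspace_eq {z : ℂ} (hz : z ≠ 0) :
    Module.rank ℂ (eigenspace ρ z) = Module.rank ℂ
      (Module.End.eigenspace (symmOperator hρ : Module.End ℂ L2) z⁻¹) := by
  rw [eigenspace_eq hρ hz]
  have h1 : ((dirichletInverse * mulOperator ρ hρ : L2 →L[ℂ] L2) : Module.End ℂ L2) =
      (dirichletSqrt : Module.End ℂ L2) *
        ((dirichletSqrt * mulOperator ρ hρ : L2 →L[ℂ] L2) : Module.End ℂ L2) := by
    rw [← ContinuousLinearMap.toLinearMap_mul, ← mul_assoc, dirichletSqrt_mul_self]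
  have h2 : (symmOperator hρ : Module.End ℂ L2) =
      ((dirichletSqrt * mulOperator ρ hρ : L2 →L[ℂ] L2) : Module.End ℂ L2) *
        (dirichletSqrt : Module.End ℂ L2) := rfl
  rw [h1, h2]
  exact (eigenspaceMulComm _ _ (inv_ne_zero hz)).rank_eq

/-- The eigenvalues form an infinite sequence of positive numbers, and the reciprocals of the
eigenvalues are the eigenvalues of `A^{1/2} M_ρ A^{1/2}`. -/
theorem exists_isEigenvalueSequence (hpos : ∀ᵐ x ∂μ01, 0 < ρ x) :
    ∃ lam : ℕ → ℝ, (∀ k, 0 < lam k) ∧ IsEigenvalueSequence ρ (fun k => (lam k : ℂ)) ∧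
      ∃ (ι : Type) (e : HilbertBasis ι ℂ L2) (σ : ℕ ≃ ι),
        ∀ k, symmOperator hρ (e (σ k)) = ((lam k : ℂ))⁻¹ • e (σ k) := by
  have hsymm := symmOperator_isSymmetric hρ hpos
  obtain ⟨ι, e, m, he⟩ := (isHilbertSchmidt_symmOperator hρ).exists_eigenbasis hsymm
  have hm : ∀ k, 0 < m k := fun k => by
    have h1 := ((ContinuousLinearMap.nonneg_iff_isPositive _).1
      (symmOperator_nonneg hρ hpos)).re_inner_nonneg_right (e k)
    rw [he, inner_smul_right, inner_self_eq_norm_sq_to_K, e.orthonormal.1 k] at h1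
    have h2 : 0 ≤ m k := by simpa using h1
    refine h2.lt_of_ne fun h0 => ?_
    have h3 : symmOperator hρ (e k) = symmOperator hρ 0 := by
      rw [he, ← h0, Complex.ofReal_zero, zero_smul, map_zero]
    have h4 := e.orthonormal.1 k
    rw [symmOperator_injective hρ hpos h3, norm_zero] at h4
    exact zero_ne_one h4
  -- Square summability of the strictly positive `m k` makes the index set countable and each
  -- multiplicity finite.
  have hsum : Summable fun k => m k ^ 2 := by
    refine (isHilbertSchmidt_symmOperator hρ ι e).congr fun k => ?_
    rw [he, norm_smul, e.orthonormal.1 k, mul_one, Complex.norm_real, Real.norm_eq_abs, sq_abs]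
  have hcount : Countable ι := by
    have h := hsum.countable_support
    have h1 : Function.support (fun k => m k ^ 2) = univ :=
      eq_univ_of_forall fun k => (pow_pos (hm k) 2).ne'
    rw [h1] at h
    exact countable_univ_iff.1 h
  have hinf : Infinite ι := by
    by_contra hfin
    rw [not_infinite_iff_finite] at hfin
    have := Fintype.ofFinite ι
    have := e.toOrthonormalBasis.toBasis.finiteDimensional_of_finite
    have h := orthonormal_phiL2.linearIndependent.finite_of_isNoetherian
    exact not_finite ℕ+
  have hfinite : ∀ z : ℂ, z ≠ 0 → {k | (m k : ℂ) = z}.Finite := fun z hz => by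
    have h1 : ∀ᶠ k in cofinite, m k ^ 2 ≠ ‖z‖ ^ 2 :=
      hsum.tendsto_cofinite_zero.eventually_ne (pow_ne_zero 2 (norm_ne_zero_iff.2 hz)).symm
    refine (eventually_cofinite.1 h1).subset fun k hk => ?_
    have hk' : (m k : ℂ) = z := hk
    simp [← hk']
  obtain ⟨σ⟩ := nonempty_equiv_of_countable (α := ℕ) (β := ι)
  refine ⟨fun k => (m (σ k))⁻¹, fun k => inv_pos.2 (hm _), fun z => ?_, ι, e, σ, fun k => ?_⟩
  · rcases eq_or_ne z 0 with rfl | hz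
    · have h1 : {k | (((m (σ k))⁻¹ : ℝ) : ℂ) = 0} = ∅ :=
        eq_empty_of_forall_notMem fun k hk => (inv_pos.2 (hm (σ k))).ne' (by exact_mod_cast hk)
      rw [h1, eigenspace_zero, rank_bot]
      simp
    · rw [rank_eigenspace_eq hρ hz, toENat_rank_eigenspace hsymm e he (hfinite _ (inv_ne_zero hz)),
        ← encard_preimage_of_bijective σ.bijective]
      congr 1
      ext k
      simp only [mem_ofPred_eq, mem_preimage, Complex.ofReal_inv]
      exact inv_eq_iff_eq_inv
  · rw [he]
    simp

/-- Any two eigenvalue listings differ by a permutation, so it suffices to treat the one read off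
from an eigenbasis. -/
theorem hasSum_inv_eigenvalue_pow (hpos : ∀ᵐ x ∂μ01, 0 < ρ x) {s : ℕ} {τ : ℂ}
    (hτ : ∀ (ι : Type) (e : HilbertBasis ι ℂ L2),
      HasSum (fun k => ⟪e k, (symmOperator hρ ^ s) (e k)⟫_ℂ) τ)
    {lam : ℕ → ℂ} (hlam : IsEigenvalueSequence ρ lam) :
    HasSum (fun k => (lam k)⁻¹ ^ s) τ := by
  obtain ⟨lam', -, hlam', ι, e, σ, he⟩ := exists_isEigenvalueSequence hρ hpos
  obtain ⟨π, hπ⟩ := exists_perm_of_encard_eq fun z => (hlam z).trans (hlam' z).symm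
  refine (((π.trans σ).hasSum_iff).2 (hτ ι e)).congr_fun fun k => ?_
  have hpow : ∀ (n j : ℕ), (symmOperator hρ ^ n) (e (σ j)) = ((lam' j : ℂ))⁻¹ ^ n • e (σ j) := by
    intro n j
    induction n with
    | zero => simp
    | succ n ih =>
      rw [pow_succ']
      change symmOperator hρ ((symmOperator hρ ^ n) (e (σ j))) = _
      rw [ih, map_smul, he, smul_smul, pow_succ]
  simp only [Function.comp_apply, Equiv.trans_apply]
  rw [hpow, inner_smul_right, inner_self_eq_norm_sq_to_K, e.orthonormal.1, ← hπ]
  simp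

end Operators

/-! ### Closed index paths and the cyclic integral. -/

section Cyclic

theorem summable_fin_prod {β : Type*} {u : β → ℝ} (hu : Summable u) (h0 : ∀ b, 0 ≤ u b) (m : ℕ) :
    Summable fun n : Fin m → β => ∏ i, u (n i) := by
  induction m with
  | zero => exact (hasSum_unique _).summable
  | succ m ih =>
    rw [← (Fin.consEquiv fun _ : Fin (m + 1) => β).summable_iff]
    refine (hu.mul_of_nonneg ih h0 fun n => Finset.prod_nonneg fun i _ => h0 _).congr fun p => ?_
    simp [Fin.prod_univ_succ, Fin.consEquiv]

theorem hasSum_fin_prod {β : Type*} {u : β → ℝ} (hu : Summable u) {m : ℕ} {f : Fin m → β → ℝ}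
    {S : Fin m → ℝ} (hf : ∀ i b, ‖f i b‖ ≤ u b) (h : ∀ i, HasSum (f i) (S i)) :
    HasSum (fun n : Fin m → β => ∏ i, f i (n i)) (∏ i, S i) := by
  induction m with
  | zero => simp
  | succ m ih =>
    have h0 : ∀ b, 0 ≤ u b := fun b => (norm_nonneg _).trans (hf 0 b)
    have h1 := ih (fun i => hf i.succ) fun i => h i.succ
    rw [← (Fin.consEquiv fun _ : Fin (m + 1) => β).hasSum_iff, Fin.prod_univ_succ]
    refine ((h 0).mul h1 (Summable.of_norm_bounded
      (hu.mul_of_nonneg (summable_fin_prod hu h0 m) h0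
        fun n => Finset.prod_nonneg fun i _ => h0 _) fun p => ?_)).congr_fun fun p => ?_
    · rw [norm_mul, norm_prod]
      exact mul_le_mul (hf 0 _) (Finset.prod_le_prod (fun _ _ => norm_nonneg _)
        fun i _ => hf i.succ _) (Finset.prod_nonneg fun _ _ => norm_nonneg _) (h0 _)
    · simp [Fin.prod_univ_succ, Fin.consEquiv]

/-- The product of the entries of `M` along the path from `i` to `j` through `k`. -/
def pathProd (M : ℕ+ → ℕ+ → ℝ) : (m : ℕ) → ℕ+ → (Fin m → ℕ+) → ℕ+ → ℝ
  | 0, i, _, j => M i j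
  | m + 1, i, k, j => M i (k 0) * pathProd M m (k 0) (Fin.tail k) j

theorem pathProd_eq_prod (M : ℕ+ → ℕ+ → ℝ) (m : ℕ) (k : Fin (m + 1) → ℕ+) (j : ℕ+) :
    pathProd M m (k 0) (Fin.tail k) j =
      (∏ l : Fin m, M (k l.castSucc) (k l.succ)) * M (k (Fin.last m)) j := by
  induction m with
  | zero => simp [pathProd]
  | succ m ih =>
    rw [pathProd, ih (Fin.tail k), Fin.prod_univ_succ, mul_assoc]
    rfl

/-- `finRotate` sends the last index to `0`, which closes the path at its starting point. -/
theorem prod_finRotate_eq_pathProd (M : ℕ+ → ℕ+ → ℝ) (m : ℕ) (k : Fin (m + 1) → ℕ+) :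
    ∏ i, M (k i) (k (finRotate (m + 1) i)) = pathProd M m (k 0) (Fin.tail k) (k 0) := by
  rw [pathProd_eq_prod, Fin.prod_univ_castSucc, finRotate_last]
  congr 1
  refine Finset.prod_congr rfl fun l _ => ?_
  rw [finRotate_apply, Fin.coeSucc_eq_succ]

variable {M : ℕ+ → ℕ+ → ℝ} {C : ℝ} {a : ℕ+ → ℝ}

/-- Each interior index ends one factor and begins the next, so it contributes `a ^ 2`, which is
summable in the application. -/
theorem abs_pathProd_le (hC : 0 ≤ C) (ha : ∀ i, 0 ≤ a i) (hM : ∀ i j, |M i j| ≤ C * (a i * a j))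
    (m : ℕ) (i : ℕ+) (k : Fin m → ℕ+) (j : ℕ+) :
    |pathProd M m i k j| ≤ C * (a i * a j) * ∏ l, (C * a (k l) ^ 2) := by
  induction m generalizing i with
  | zero => simpa [pathProd] using hM i j
  | succ m ih =>
    rw [pathProd, abs_mul, Fin.prod_univ_succ]
    refine (mul_le_mul (hM i (k 0)) (ih (k 0) (Fin.tail k)) (abs_nonneg _)
      (mul_nonneg hC (mul_nonneg (ha _) (ha _)))).trans_eq ?_
    simp only [Fin.tail]
    ring

theorem hasSum_pathProd (hC : 0 ≤ C) (ha : ∀ i, 0 ≤ a i) (hM : ∀ i j, |M i j| ≤ C * (a i * a j))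
    (hs : Summable fun i => a i ^ 2) (m : ℕ) (i j : ℕ+) :
    HasSum (fun k => pathProd M m i k j) (matrixPow M (m + 1) i j) := by
  induction m generalizing i with
  | zero =>
    have h : matrixPow M 1 i j = M i j := by
      simp only [matrixPow]
      rw [tsum_eq_single j fun k hk => by simp [hk]]
      simp
    rw [h]
    exact hasSum_unique _
  | succ m ih =>
    have hsum : Summable fun k : Fin (m + 1) → ℕ+ => pathProd M (m + 1) i k j :=
      Summable.of_norm_bounded ((summable_fin_prod (hs.mul_left C)
        (fun b => mul_nonneg hC (sq_nonneg _)) (m + 1)).mul_left (C * (a i * a j)))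
        fun k => abs_pathProd_le hC ha hM (m + 1) i k j
    have h := (Fin.consEquiv fun _ : Fin (m + 1) => ℕ+).hasSum_iff.2 hsum.hasSum
    have h1 := h.prod_fiberwise (g := fun k => M i k * matrixPow M (m + 1) k j)
      fun k => ((ih k).mul_left (M i k)).congr_fun fun t => by
        simp [pathProd, Fin.consEquiv]
    have h2 : matrixPow M (m + 1 + 1) i j = _ := h1.tsum_eq
    rw [h2]
    exact hsum.hasSum

theorem hasSum_diag_of_hasSum_cyclic (hC : 0 ≤ C) (ha : ∀ i, 0 ≤ a i)
    (hM : ∀ i j, |M i j| ≤ C * (a i * a j)) (hs : Summable fun i => a i ^ 2) (m : ℕ) {t : ℝ}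
    (h : HasSum (fun k : Fin (m + 1) → ℕ+ => ∏ i, M (k i) (k (finRotate (m + 1) i))) t) :
    HasSum (fun i => matrixPow M (m + 1) i i) t := by
  have h1 := (Fin.consEquiv fun _ : Fin (m + 1) => ℕ+).hasSum_iff.2 h
  refine h1.prod_fiberwise fun i => (hasSum_pathProd hC ha hM hs m i i).congr_fun fun k => ?_
  rw [Function.comp_apply, prod_finRotate_eq_pathProd]
  simp [Fin.consEquiv]

theorem continuous_green : Continuous fun p : ℝ × ℝ => green p.1 p.2 := by
  simp only [green_eq]
  fun_prop

theorem abs_green_le {x y : ℝ} (hx : x ∈ Icc (0 : ℝ) 1) (hy : y ∈ Icc (0 : ℝ) 1) :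
    |green x y| ≤ 1 := by
  have hx0 := hx.1
  have hx1 := hx.2
  have hy0 := hy.1
  have hy1 := hy.2
  rw [abs_le]
  unfold green
  split_ifs <;> constructor <;> nlinarith

theorem ae_pi_mem_Icc (s : ℕ) :
    ∀ᵐ x ∂(Measure.pi fun _ : Fin s => μ01), ∀ i, x i ∈ Icc (0 : ℝ) 1 := by
  refine ae_all_iff.2 fun i => ?_
  refine (Measure.quasiMeasurePreserving_eval (fun _ : Fin s => μ01) i).ae ?_
  filter_upwards [ae_restrict_mem measurableSet_Ioo] with x hx using Ioo_subset_Icc_self hx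

variable {ρ : ℝ → ℝ}

theorem cyclicIntegrand_eq (s : ℕ) (x : Fin s → ℝ) :
    cyclicIntegrand ρ s x = (∏ i, green (x i) (x (finRotate s i))) * ∏ i, ρ (x i) := by
  rw [cyclicIntegrand, Finset.prod_mul_distrib, mul_comm]

theorem integrable_cyclicIntegrand (hρ : Integrable ρ μ01) (s : ℕ) :
    Integrable (cyclicIntegrand ρ s) (Measure.pi fun _ => μ01) := by
  have h1 : Integrable (fun x : Fin s → ℝ => ∏ i, ρ (x i)) (Measure.pi fun _ => μ01) :=
    Integrable.fintype_prod fun _ => hρ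
  have h2 : Continuous fun x : Fin s → ℝ => ∏ i, green (x i) (x (finRotate s i)) :=
    continuous_finsetProd _ fun i _ => continuous_green.comp
      (g := fun p : ℝ × ℝ => green p.1 p.2) (f := fun x : Fin s → ℝ => (x i, x (finRotate s i)))
      ((continuous_apply i).prodMk (continuous_apply (finRotate s i)))
  refine (h1.bdd_mul (c := 1) h2.aestronglyMeasurable ?_).congr
    (Eventually.of_forall fun x => (cyclicIntegrand_eq s x).symm)
  filter_upwards [ae_pi_mem_Icc s] with x hx
  rw [norm_prod]
  exact Finset.prod_le_one (fun _ _ => norm_nonneg _) fun i _ => abs_green_le (hx _) (hx _)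

theorem integrable_phi_mul (hρ : Integrable ρ μ01) (i j : ℕ+) :
    Integrable (fun x => phi i x * phi j x * ρ x) μ01 :=
  hρ.bdd_mul (c := 2) ((continuous_phi i).mul (continuous_phi j)).aestronglyMeasurable
    (Eventually.of_forall fun x => abs_phi_mul_phi_le i j x x)

theorem integral_norm_phi_mul_le (hρ : Integrable ρ μ01) (i j : ℕ+) :
    ∫ x, ‖phi i x * phi j x * ρ x‖ ∂μ01 ≤ 2 * ∫ x, ‖ρ x‖ ∂μ01 := by
  rw [← integral_const_mul]
  refine integral_mono (integrable_phi_mul hρ i j).norm (hρ.norm.const_mul 2) fun x => ?_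
  dsimp only
  rw [norm_mul]
  exact mul_le_mul_of_nonneg_right (abs_phi_mul_phi_le i j x x) (norm_nonneg _)

theorem momentMatrix_symm (ρ : ℝ → ℝ) (i j : ℕ+) : momentMatrix ρ i j = momentMatrix ρ j i := by
  simp only [momentMatrix, mul_comm (phi i _), mul_right_comm _ (i : ℝ)]

theorem momentMatrix_eq (ρ : ℝ → ℝ) (i j : ℕ+) : momentMatrix ρ i j =
    ((i : ℝ) * Real.pi)⁻¹ * ((j : ℝ) * Real.pi)⁻¹ * ∫ x, phi i x * phi j x * ρ x ∂μ01 := by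
  rw [momentMatrix, one_div, ← mul_inv]
  congr 2
  ring

theorem abs_momentMatrix_le (hρ : Integrable ρ μ01) (i j : ℕ+) :
    |momentMatrix ρ i j| ≤
      (2 * ∫ x, ‖ρ x‖ ∂μ01) * (((i : ℝ) * Real.pi)⁻¹ * ((j : ℝ) * Real.pi)⁻¹) := by
  rw [momentMatrix_eq, abs_mul, abs_of_nonneg (by positivity :
    0 ≤ ((i : ℝ) * Real.pi)⁻¹ * ((j : ℝ) * Real.pi)⁻¹), mul_comm]
  refine mul_le_mul_of_nonneg_right ?_ (by positivity)
  exact (norm_integral_le_integral_norm _).trans (integral_norm_phi_mul_le hρ i j)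

/-- The sine series of the Green's function turns the cyclic integral into a sum of cyclic products
of entries of the moment matrix. -/
theorem hasSum_cyclic_momentMatrix (hρ : Integrable ρ μ01) (s : ℕ) :
    HasSum (fun n : Fin s → ℕ+ => ∏ i, momentMatrix ρ (n i) (n (finRotate s i)))
      (∫ x, cyclicIntegrand ρ s x ∂(Measure.pi fun _ => μ01)) := by
  let σ := finRotate s
  let c : ℕ+ → ℝ := fun n => ((n : ℝ) ^ 2 * Real.pi ^ 2)⁻¹
  have hc0 : ∀ n, 0 ≤ c n := fun n => by positivity
  -- Factors are regrouped by variable: `x i` occurs in the Green's functions numbered `i` and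
  -- `σ.symm i`, so the multiple integral splits into single ones.
  let G : (Fin s → ℕ+) → Fin s → ℝ → ℝ := fun n i y =>
    c (n i) * (phi (n i) y * phi (n (σ.symm i)) y * ρ y)
  have hG : ∀ n i, Integrable (G n i) μ01 := fun n i => (integrable_phi_mul hρ _ _).const_mul _
  have hprod : ∀ (n : Fin s → ℕ+) (x : Fin s → ℝ), ∏ i, G n i (x i) =
      (∏ i, c (n i) * phi (n i) (x i) * phi (n i) (x (σ i))) * ∏ i, ρ (x i) := fun n x => by
    have h1 : ∏ i, phi (n i) (x (σ i)) = ∏ i, phi (n (σ.symm i)) (x i) := by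
      rw [← Equiv.prod_comp σ fun i => phi (n (σ.symm i)) (x i)]
      simp
    simp only [G, Finset.prod_mul_distrib, h1]
    ring
  have hint : ∀ n, Integrable (fun x : Fin s → ℝ => ∏ i, G n i (x i)) (Measure.pi fun _ => μ01) :=
    fun n => Integrable.fintype_prod fun i => hG n i
  have hnorm : Summable fun n => ∫ x : Fin s → ℝ, ‖∏ i, G n i (x i)‖ ∂(Measure.pi fun _ => μ01) := by
    have h0 : 0 ≤ 2 * ∫ x, ‖ρ x‖ ∂μ01 :=
      mul_nonneg zero_le_two (integral_nonneg fun _ => norm_nonneg _)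
    refine Summable.of_nonneg_of_le (fun n => integral_nonneg fun _ => norm_nonneg _) (fun n => ?_)
      (summable_fin_prod (summable_inv_sq_mul_pi_sq.mul_right (2 * ∫ x, ‖ρ x‖ ∂μ01))
        (fun b => mul_nonneg (hc0 b) h0) s)
    simp only [norm_prod]
    rw [integral_fintype_prod_eq_prod fun i y => ‖G n i y‖]
    refine Finset.prod_le_prod (fun i _ => integral_nonneg fun _ => norm_nonneg _) fun i _ => ?_
    simp only [G, norm_mul (c _), Real.norm_of_nonneg (hc0 _)]
    rw [integral_const_mul]
    exact mul_le_mul_of_nonneg_left (integral_norm_phi_mul_le hρ _ _) (hc0 _)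
  have h := hasSum_integral_of_summable_integral_norm hint hnorm
  have hval : ∀ n, ∫ x : Fin s → ℝ, ∏ i, G n i (x i) ∂(Measure.pi fun _ => μ01) =
      ∏ i, momentMatrix ρ (n i) (n (σ i)) := fun n => by
    rw [integral_fintype_prod_eq_prod fun i y => G n i y]
    have h1 : ∏ i, momentMatrix ρ (n i) (n (σ i)) = ∏ i, momentMatrix ρ (n i) (n (σ.symm i)) := by
      rw [← Equiv.prod_comp σ fun i => momentMatrix ρ (n i) (n (σ.symm i))]
      simp only [Equiv.symm_apply_apply]
      exact Finset.prod_congr rfl fun i _ => momentMatrix_symm ρ _ _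
    -- Around the cycle, the weights `1 / (n π)²` of the series can be split evenly between
    -- neighbouring matrix entries.
    have h2 : ∏ i, (((n (σ.symm i) : ℕ+) : ℝ) * Real.pi)⁻¹ = ∏ i, ((n i : ℝ) * Real.pi)⁻¹ :=
      Equiv.prod_comp σ.symm fun i => ((n i : ℝ) * Real.pi)⁻¹
    rw [h1]
    simp only [G, momentMatrix_eq, integral_const_mul, Finset.prod_mul_distrib, h2]
    congr 1
    rw [← Finset.prod_mul_distrib]
    refine Finset.prod_congr rfl fun i _ => ?_
    simp only [c]
    rw [← mul_inv]
    congr 1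
    ring
  have hlim : ∫ x : Fin s → ℝ, ∑' n, ∏ i, G n i (x i) ∂(Measure.pi fun _ => μ01) =
      ∫ x, cyclicIntegrand ρ s x ∂(Measure.pi fun _ => μ01) := by
    refine integral_congr_ae ?_
    filter_upwards [ae_pi_mem_Icc s] with x hx
    simp only [hprod]
    rw [cyclicIntegrand_eq]
    refine ((hasSum_fin_prod (summable_inv_sq_mul_pi_sq.mul_right 2) (fun i n => ?_)
      fun i => hasSum_green (hx i) (hx (σ i))).mul_right _).tsum_eq
    exact norm_sine_term_le n _ _
  rw [hlim] at h
  exact h.congr_fun fun n => (hval n).symm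

theorem integral_cyclicIntegrand_eq (hρ : Integrable ρ μ01) {s : ℕ} (hs : 1 ≤ s) {τ : ℝ}
    (hτ : HasMatrixPowTrace (momentMatrix ρ) s τ) :
    ∫ x, cyclicIntegrand ρ s x ∂(Measure.pi fun _ => μ01) = τ := by
  obtain ⟨m, rfl⟩ := Nat.exists_eq_add_of_le' hs
  have h := hasSum_diag_of_hasSum_cyclic
    (mul_nonneg zero_le_two (integral_nonneg fun _ => norm_nonneg _)) (fun i => by positivity)
    (abs_momentMatrix_le hρ) (summable_inv_sq_mul_pi_sq.congr fun n => by rw [inv_pow, mul_pow]) m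
    (hasSum_cyclic_momentMatrix hρ (m + 1))
  exact h.unique hτ.2

end Cyclic

end StringTrace

end

theorem mainTheorem2 (ρ : ℝ → ℝ) (hρ : MemLp ρ ∞ StringTrace.μ01)
    (hpos : ∀ᵐ x ∂StringTrace.μ01, 0 < ρ x) :
    -- the eigenvalues are positive and form an infinite sequence
    (∃ lam : ℕ → ℝ, (∀ k, 0 < lam k) ∧
      StringTrace.IsEigenvalueSequence ρ (fun k => (lam k : ℂ))) ∧
    -- `g` is the integral kernel of `A = (-Δ_D)⁻¹`
    (∀ f : StringTrace.L2, StringTrace.dirichletInverse f =ᵐ[StringTrace.μ01]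
      fun x => ∫ y, (StringTrace.green x y : ℂ) * f y ∂StringTrace.μ01) ∧
    -- the sine expansion of the Green's function, uniformly on the square
    TendstoUniformlyOn
      (fun (N : Finset ℕ+) (p : ℝ × ℝ) =>
        ∑ n ∈ N, ((n : ℝ) ^ 2 * Real.pi ^ 2)⁻¹ * StringTrace.phi n p.1 * StringTrace.phi n p.2)
      (fun p => StringTrace.green p.1 p.2) atTop (Icc (0 : ℝ) 1 ×ˢ Icc (0 : ℝ) 1) ∧
    -- the trace formulas
    ∀ s : ℕ, 1 ≤ s → ∃ τ : ℝ,
      StringTrace.HasTrace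
        ((StringTrace.dirichletInverse ∘L StringTrace.mulOperator ρ hρ) ^ s) (τ : ℂ) ∧
      (∀ lam : ℕ → ℂ, StringTrace.IsEigenvalueSequence ρ lam →
        HasSum (fun k => (lam k)⁻¹ ^ s) (τ : ℂ)) ∧
      Integrable (StringTrace.cyclicIntegrand ρ s) (Measure.pi fun _ => StringTrace.μ01) ∧
      ∫ x, StringTrace.cyclicIntegrand ρ s x ∂(Measure.pi fun _ => StringTrace.μ01) = τ ∧
      StringTrace.HasMatrixPowTrace (StringTrace.momentMatrix ρ) s τ := by
  obtain ⟨lam, hlam, hseq, -⟩ := StringTrace.exists_isEigenvalueSequence hρ hpos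
  have hint : Integrable ρ StringTrace.μ01 := hρ.integrable le_top
  refine ⟨⟨lam, hlam, hseq⟩, StringTrace.dirichletInverse_eq_integral_green,
    StringTrace.tendstoUniformlyOn_green, fun s hs => ?_⟩
  obtain ⟨τ, htr, hT, hmat⟩ := StringTrace.exists_trace hρ hpos hs
  exact ⟨τ, htr, fun lam' h' => StringTrace.hasSum_inv_eigenvalue_pow hρ hpos hT h',
    StringTrace.integrable_cyclicIntegrand hint s,
    StringTrace.integral_cyclicIntegrand_eq hint hs hmat, hmat⟩
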